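/- \textbf{Setting.} Fix $d\in\mathbb N$. For $\mu_1,\mu_2\in\mathbb R^d$ and $\sigma_1,\sigma_2>0$ let $P=P_{\sigma_1}$ denote the law of $(Y,X)$, where $Y$ is uniform on $\{1,2\}$ and $X\mid Y=j\sim\mathcal N(\mu_j,\sigma_j^2 I_d)$. The two Gaussians are $\alpha$-separated if $\|\mu_1-\mu_2\|_2=\alpha(\sigma_1+\sigma_2)$; assume $\sigma_1<\sigma_2$ and put $\gamma=\sigma_2/\sigma_1$. For a probability measure $R$ on $\{1,2\}\times\mathbb R^d$ (the law $P$, or the empirical measure $P_N$ of $N$ labelled samples), the output of 2-means on $R$ is a pair of centers $\theta=(\theta_1,\theta_2)$ that minimizes $\mathbb E_R\min_j\|X-\theta_j\|_2^2$ and is therefore a fixed point of the 2-means iteration, $\theta_j=\mathbb E_R[X\mid\hat Y=j]$ for each nonempty cluster, where $\hat Y=\arg\min_j\|X-\theta_j\|_2$. Cluster and class IDs are aligned: $R(\hat Y=Y)\ge R(\hat Y\ne Y)$. For centers $\theta$ the accuracy on class $j$ with respect to $R$ is $\mathrm{ACC}_j^R(\theta)=R(\hat Y=j\mid Y=j)$.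 \textbf{Theorem.} Let $\mu_1,\mu_2\in\mathbb R^d$ and $\sigma_2>0$. (1) ($\mathrm{ACC}_2$ is positively correlated with $\sigma_1$.) Let $0<\sigma_1<\sigma_1'$ be two values of the first standard deviation such that, for each of them, $1<\gamma<2$ and the two Gaussians are $\alpha$-separated for some $1.5<\alpha<3$. Put $P=P_{\sigma_1}$ and $P'=P_{\sigma_1'}$. Then $\mathrm{ACC}_2^{P}(\theta)<\mathrm{ACC}_2^{P'}(\theta')$ for all aligned 2-means outputs $\theta$ on $P$ and $\theta'$ on $P'$. Moreover, for every $\delta>0$ there is $\bar N$ such that for all $N\ge\bar N$ the following holds: whatever the joint law of an i.i.d. sample of size $N$ from $P$ and an i.i.d. sample of size $N$ from $P'$, with probability at least $1-\delta$ all aligned 2-means outputs $\theta$ on the first sample and $\theta'$ on the second satisfy $\mathrm{ACC}_2^{P}(\theta)<\mathrm{ACC}_2^{P'}(\theta')$ and $\mathrm{ACC}_2^{P_N}(\theta)<\mathrm{ACC}_2^{P'_N}(\theta')$, where $P_N$ and $P_N'$ are the empirical measures of the two samples. (2) Let $\sigma_1>0$ be such that $1<\gamma<2$ and the two Gaussians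 are $\alpha$-separated with $\alpha>3$. Then $|1-\mathrm{ACC}_j^P(\theta)|<0.05$ for $j=1,2$ and every aligned 2-means output $\theta$ on $P$. Moreover, for every $\delta>0$ there is $\bar N$ such that for all $N\ge\bar N$, with probability at least $1-\delta$ over an i.i.d. sample of size $N$ from $P$, every aligned 2-means output $\theta$ on the sample satisfies $|1-\mathrm{ACC}_j^P(\theta)|<0.05$ and $|1-\mathrm{ACC}_j^{P_N}(\theta)|<0.05$ for $j=1,2$. -/

import Mathlib

open MeasureTheory ProbabilityTheory
open scoped ENNReal

noncomputable section

namespace TwoMeans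

/-- A labelled data point: its class label and its position in `ℝ^d`.
Labels live in `Fin 2`: label `0` stands for class 1 and label `1` for class 2
(likewise for cluster IDs). -/
abbrev Datum (d : ℕ) : Type := Fin 2 × EuclideanSpace ℝ (Fin d)

/-- The spherical Gaussian `N(m, s² I)` on `ℝ^d`. -/
def sphericalGaussian {d : ℕ} (m : EuclideanSpace ℝ (Fin d)) (s : ℝ) :
    Measure (EuclideanSpace ℝ (Fin d)) :=
  multivariateGaussian m ((s ^ 2) • (1 : Matrix (Fin d) (Fin d) ℝ))

/-- The data-generating law of `(Y, X)`: `Y` is uniform on the two classes and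
`X ∼ N(μ_j, σ_j² I)` given that `Y` is class `j`. -/
def mixture {d : ℕ} (μ₁ μ₂ : EuclideanSpace ℝ (Fin d)) (σ₁ σ₂ : ℝ) : Measure (Datum d) :=
  (2 : ℝ≥0∞)⁻¹ • ((Measure.dirac (0 : Fin 2)).prod (sphericalGaussian μ₁ σ₁) +
    (Measure.dirac (1 : Fin 2)).prod (sphericalGaussian μ₂ σ₂))

/-- `N(μ₁, σ₁² I)` and `N(μ₂, σ₂² I)` are `α`-separated; `σ_j²` is the largest eigenvalue of
`σ_j² I`. -/
def IsSeparated {d : ℕ} (α : ℝ) (μ₁ μ₂ : EuclideanSpace ℝ (Fin d)) (σ₁ σ₂ : ℝ) : Prop :=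
  ‖μ₁ - μ₂‖ = α * (σ₁ + σ₂)

/-- The law of `N` independent labelled samples. -/
def sampleLaw {d : ℕ} (N : ℕ) (μ₁ μ₂ : EuclideanSpace ℝ (Fin d)) (σ₁ σ₂ : ℝ) :
    Measure (Fin N → Datum d) :=
  Measure.pi fun _ => mixture μ₁ μ₂ σ₁ σ₂

/-- The empirical measure of a labelled sample. -/
def empirical {d N : ℕ} (S : Fin N → Datum d) : Measure (Datum d) :=
  (N : ℝ≥0∞)⁻¹ • ∑ i, Measure.dirac (S i)

/-- The cluster ID of `x` for the centers `θ`: the index of the nearest center (a tie goes to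
cluster 1). -/
def predict {d : ℕ} (θ : Fin 2 → EuclideanSpace ℝ (Fin d)) (x : EuclideanSpace ℝ (Fin d)) :
    Fin 2 :=
  if ‖x - θ 0‖ ≤ ‖x - θ 1‖ then 0 else 1

/-- The 2-means cost of the centers `θ` on data with law `P` (for the empirical measure of a
sample: the average squared distance to the nearest center). -/
def cost {d : ℕ} (P : Measure (Datum d)) (θ : Fin 2 → EuclideanSpace ℝ (Fin d)) : ℝ :=
  ∫ p, min (‖p.2 - θ 0‖ ^ 2) (‖p.2 - θ 1‖ ^ 2) ∂P

/-- `θ` is an output of 2-means on data with law `P`. -/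
structure IsTwoMeans {d : ℕ} (P : Measure (Datum d)) (θ : Fin 2 → EuclideanSpace ℝ (Fin d)) :
    Prop where
  /-- The update step has converged: every center is the average of the data of its cluster. -/
  converged : ∀ j, P.real {p | predict θ p.2 = j} • θ j = ∫ p in {p | predict θ p.2 = j}, p.2 ∂P
  /-- The centers are optimal. -/
  optimal : ∀ η, cost P θ ≤ cost P η

/-- Cluster IDs and class IDs are aligned: of the two ways to match clusters with classes, the
identity maximizes the mass of the data whose cluster is matched with its class. -/
def IsAligned {d : ℕ} (P : Measure (Datum d)) (θ : Fin 2 → EuclideanSpace ℝ (Fin d)) : Prop :=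
  P {p | predict θ p.2 ≠ p.1} ≤ P {p | predict θ p.2 = p.1}

/-- The accuracy on class `j` of the clustering with centers `θ`, on data with law `P`: the
conditional probability that the cluster ID is `j` given that the class is `j`. -/
def acc {d : ℕ} (P : Measure (Datum d)) (θ : Fin 2 → EuclideanSpace ℝ (Fin d)) (j : Fin 2) : ℝ :=
  (cond P {p | p.1 = j}).real {p | predict θ p.2 = j}

/-- `A` holds with `Q`-probability at least `r`. -/
def HoldsWithProb {Ω : Type*} [MeasurableSpace Ω] (Q : Measure Ω) (r : ℝ) (A : Ω → Prop) : Prop :=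
  ∃ G : Set Ω, MeasurableSet G ∧ ENNReal.ofReal r ≤ Q G ∧ ∀ ω ∈ G, A ω

end TwoMeans

end

namespace TwoMeans

open Filter Topology Set
open scoped RealInnerProductSpace

/-! Optimal centers are distinct, because the class means beat every single center
(`cost_class_means_add_le`), so they cut space by a hyperplane. Moving one center against a fixed
assignment shows that each center is the mean of its cluster. Orthogonally to the cut this forces
the normal to be parallel to `μ₂ - μ₁`, unless the cut takes equal shares of both classes; such a
cut leaves too little spread between the centers to be optimal (`tail_ne_of_optimal`). Along the
normal it says that the cut is the midpoint of the two cluster means. With lengths measured in units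
of `σ₂`, `r = σ₁ / σ₂` and `D = ‖μ₁ - μ₂‖ / σ₂`, this becomes the scalar equation `balance r D t =
0` for a threshold `0 < t < D`, and the accuracies are `1 - tail (t / r)` and `1 - tail (D - t)`
(`exists_balanced_threshold`).

The heart of the matter is that `balance` has positive slope in `t` at each of its zeros in `(0, D)`
(`balance_slope_pos`, by explicit normal estimates). Hence it stays positive after a zero, and since
it is negative at `D / 2`, every zero lies beyond `D / 2`. There `balance` increases with `r`, so a
larger `r` moves the zero to the left (`balanced_threshold_lt`), away from the second class mean,
and the second accuracy grows. When `D ≥ 3 * (1 + r)`, the same equation puts both class means at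
least `1.8` standard deviations from the cut, and `tail 1.8 < 0.05`.

For samples, "with probability tending to one" is encoded as a filter on measures (`sampleFilter`),
along which integrals of functions of quadratic growth converge. Cost and accuracy are then jointly
continuous in the measure and the centers, the latter away from a charged bisector; optimal centers
stay in a compact set; and failing to be optimal and aligned is an open condition. A compactness
argument carries the strict population inequalities over to all sample outputs at once. -/

/-- The density of the standard normal distribution. -/
noncomputable def stdPdf (x : ℝ) : ℝ := (√(2 * Real.pi))⁻¹ * Real.exp (-(x ^ 2 / 2))

/-- The upper tail of the standard normal distribution. -/
noncomputable def tail (z : ℝ) : ℝ := (gaussianReal 0 1).real (Ioi z)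

/-- The expected excess `E (Z - z)⁺` of a standard normal variable over `z`. -/
noncomputable def excess (z : ℝ) : ℝ := stdPdf z - z * tail z

/-! ### Calculus of the normal density, tail and expected excess -/

lemma stdPdf_eq_gaussianPDFReal : stdPdf = gaussianPDFReal 0 1 := by
  ext x
  simp [stdPdf, gaussianPDFReal, neg_div]

lemma stdPdf_pos (x : ℝ) : 0 < stdPdf x := by
  unfold stdPdf; positivity

lemma stdPdf_neg (x : ℝ) : stdPdf (-x) = stdPdf x := by simp [stdPdf]

lemma stdPdf_anti {x y : ℝ} (hx : 0 ≤ x) (hxy : x ≤ y) : stdPdf y ≤ stdPdf x := by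
  unfold stdPdf
  gcongr

lemma integrable_stdPdf : Integrable stdPdf := by
  rw [stdPdf_eq_gaussianPDFReal]; exact integrable_gaussianPDFReal 0 1

lemma continuous_stdPdf : Continuous stdPdf := by unfold stdPdf; fun_prop

lemma tail_eq_integral (z : ℝ) : tail z = ∫ x in Ioi z, stdPdf x := by
  rw [tail, Measure.real, gaussianReal_apply_eq_integral 0 one_ne_zero, stdPdf_eq_gaussianPDFReal,
    ENNReal.toReal_ofReal]
  exact integral_nonneg fun x => gaussianPDFReal_nonneg _ _ _

lemma hasDerivAt_stdPdf (x : ℝ) : HasDerivAt stdPdf (-x * stdPdf x) x := by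
  have h : HasDerivAt (fun x : ℝ => -(x ^ 2 / 2)) (-x) x := by
    have := ((hasDerivAt_pow 2 x).div_const 2).neg
    convert! this using 1
    simp
  convert! (h.exp.const_mul (√(2 * Real.pi))⁻¹) using 1
  unfold stdPdf; ring

lemma hasDerivAt_tail (z : ℝ) : HasDerivAt tail (-stdPdf z) z := by
  have h : tail = fun z => tail 0 - ∫ x in (0 : ℝ)..z, stdPdf x := by
    ext z
    have := intervalIntegral.integral_Ioi_sub_Ioi' (f := stdPdf) (μ := volume) (a := 0) (b := z)
      integrable_stdPdf.integrableOn integrable_stdPdf.integrableOn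
    rw [← this, tail_eq_integral, tail_eq_integral]; ring
  rw [h]
  exact (intervalIntegral.integral_hasDerivAt_right (integrable_stdPdf.intervalIntegrable)
    (continuous_stdPdf.stronglyMeasurableAtFilter _ _) continuous_stdPdf.continuousAt).const_sub _

lemma hasDerivAt_excess (z : ℝ) : HasDerivAt excess (-tail z) z := by
  convert! (hasDerivAt_stdPdf z).sub ((hasDerivAt_id z).mul (hasDerivAt_tail z)) using 1
  simp

lemma tail_strictAnti : StrictAnti tail :=
  strictAnti_of_deriv_neg fun x => by
    rw [(hasDerivAt_tail x).deriv]; linarith [stdPdf_pos x]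

lemma tail_nonneg (z : ℝ) : 0 ≤ tail z := measureReal_nonneg

lemma tail_pos (z : ℝ) : 0 < tail z :=
  (tail_nonneg (z + 1)).trans_lt (tail_strictAnti (by linarith))

lemma tail_neg (z : ℝ) : tail (-z) = 1 - tail z := by
  have : NullSingletonClass (gaussianReal 0 1) := nullSingletonClass_gaussianReal one_ne_zero
  have h : (gaussianReal 0 1).map (fun x => -x) = gaussianReal 0 1 := by
    simp [gaussianReal_map_neg]
  have h2 : tail (-z) = (gaussianReal 0 1).real (Iio z) := by
    rw [tail, ← h, map_measureReal_apply (by fun_prop) measurableSet_Ioi, h]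
    congr 1; ext x; simp
  rw [h2, tail, measureReal_congr Iio_ae_eq_Iic, ← compl_Ioi, probReal_compl_eq_one_sub measurableSet_Ioi]

lemma tail_zero : tail 0 = 1 / 2 := by
  have := tail_neg 0
  rw [neg_zero] at this; linarith

lemma excess_neg (z : ℝ) : excess (-z) = excess z + z := by
  simp only [excess, stdPdf_neg, tail_neg]; ring

lemma tail_lt_one (z : ℝ) : tail z < 1 := by
  have := tail_pos (-z); rw [tail_neg] at this; linarith

lemma tendsto_stdPdf : Tendsto stdPdf atTop (𝓝 0) := by
  have h : Tendsto (fun x : ℝ => x ^ 2 / 2) atTop atTop :=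
    (tendsto_pow_atTop two_ne_zero).atTop_div_const two_pos
  rw [← mul_zero (√(2 * Real.pi))⁻¹]
  exact (Real.tendsto_exp_neg_atTop_nhds_zero.comp h).const_mul (√(2 * Real.pi))⁻¹

lemma tendsto_tail : Tendsto tail atTop (𝓝 0) := by
  have h : tail = fun z => 1 - cdf (gaussianReal 0 1) z := by
    ext z
    rw [cdf_eq_real, tail, ← compl_Iic, probReal_compl_eq_one_sub measurableSet_Iic]
  rw [h]
  simpa using (tendsto_cdf_atTop (gaussianReal 0 1)).const_sub 1

lemma integrable_mul_stdPdf : Integrable fun x => x * stdPdf x := by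
  have h := integrable_mul_exp_neg_mul_sq (b := 1 / 2) (by norm_num)
  convert! h.const_mul (√(2 * Real.pi))⁻¹ using 1
  ext x; simp only [stdPdf]
  rw [show -(x ^ 2 / 2) = -(1 / 2) * x ^ 2 by ring]; ring

lemma setIntegral_id_gaussianReal (z : ℝ) : ∫ x in Ioi z, x ∂(gaussianReal 0 1) = stdPdf z := by
  rw [← integral_indicator measurableSet_Ioi, integral_gaussianReal_eq_integral_smul one_ne_zero,
    ← stdPdf_eq_gaussianPDFReal]
  have h : (fun x => stdPdf x • (Ioi z).indicator (fun x => x) x) =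
      (Ioi z).indicator fun x => x * stdPdf x := by
    ext x; by_cases hx : x ∈ Ioi z <;> simp [hx, mul_comm]
  rw [h, integral_indicator measurableSet_Ioi]
  have := integral_Ioi_of_hasDerivAt_of_tendsto' (f := fun x => -stdPdf x)
    (f' := fun x => x * stdPdf x) (a := z) (m := 0)
    (fun x _ => by convert! (hasDerivAt_stdPdf x).neg using 1; ring) integrable_mul_stdPdf.integrableOn
    (by simpa using tendsto_stdPdf.neg)
  simpa using this

lemma setIntegral_sub_gaussianReal (z : ℝ) :
    ∫ x in Ioi z, (x - z) ∂(gaussianReal 0 1) = excess z := by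
  rw [integral_sub (IsGaussian.integrable_fun_id.integrableOn) (integrable_const _).integrableOn,
    setIntegral_id_gaussianReal]
  simp [excess, tail, mul_comm]

lemma excess_nonneg (z : ℝ) : 0 ≤ excess z := by
  rw [← setIntegral_sub_gaussianReal]
  exact setIntegral_nonneg measurableSet_Ioi fun x hx => sub_nonneg.2 (le_of_lt hx)

lemma excess_antitone : Antitone excess :=
  antitone_of_deriv_nonpos (fun x => (hasDerivAt_excess x).differentiableAt) fun x => by
    rw [(hasDerivAt_excess x).deriv]; linarith [tail_pos x]

/-- A function on `[0, ∞)` with nonpositive derivative and limit `0` is nonnegative. -/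
lemma nonneg_of_deriv_nonpos_of_tendsto {f f' : ℝ → ℝ} (hf : ∀ x, 0 ≤ x → HasDerivAt f (f' x) x)
    (hf' : ∀ x, 0 ≤ x → f' x ≤ 0) (hlim : Tendsto f atTop (𝓝 0)) {z : ℝ} (hz : 0 ≤ z) :
    0 ≤ f z := by
  have hanti : AntitoneOn f (Ici 0) := by
    refine antitoneOn_of_deriv_nonpos (convex_Ici 0)
      (fun x hx => (hf x hx).continuousAt.continuousWithinAt) (fun x hx => ?_) fun x hx => ?_
    · rw [interior_Ici] at hx
      exact (hf x (le_of_lt hx)).differentiableAt.differentiableWithinAt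
    · rw [interior_Ici] at hx
      rw [(hf x (le_of_lt hx)).deriv]; exact hf' x (le_of_lt hx)
  refine le_of_tendsto hlim ?_
  filter_upwards [eventually_ge_atTop z] with x hx
  exact hanti hz (hz.trans hx) hx

/-- A Mills ratio bound: the difference `tail z - stdPdf z / (1 + z)` has derivative `-z * stdPdf z
/ (1 + z) ^ 2` and tends to `0`. -/
lemma stdPdf_le_one_add_mul_tail {z : ℝ} (hz : 0 ≤ z) : stdPdf z ≤ (1 + z) * tail z := by
  have h : 0 ≤ tail z - stdPdf z / (1 + z) := by
    refine nonneg_of_deriv_nonpos_of_tendsto (f := fun z => tail z - stdPdf z / (1 + z))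
      (f' := fun x => -stdPdf x - ((-x * stdPdf x) * (1 + x) - stdPdf x * 1) / (1 + x) ^ 2)
      (fun x hx => ?_) (fun x hx => ?_) ?_ hz
    · exact (hasDerivAt_tail x).sub
        ((hasDerivAt_stdPdf x).div ((hasDerivAt_id x).const_add 1) (by positivity))
    · have h1 : (0 : ℝ) < (1 + x) ^ 2 := by positivity
      rw [sub_nonpos, le_div_iff₀ h1]
      nlinarith [mul_nonneg hx (stdPdf_pos x).le]
    · have h1 : Tendsto (fun z : ℝ => 1 + z) atTop atTop := tendsto_atTop_add_const_left _ _ tendsto_id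
      simpa using tendsto_tail.sub (tendsto_stdPdf.div_atTop h1)
  rw [sub_nonneg, div_le_iff₀ (by positivity)] at h
  linarith

lemma excess_le_tail {z : ℝ} (hz : 0 ≤ z) : excess z ≤ tail z := by
  have := stdPdf_le_one_add_mul_tail hz
  unfold excess; linarith

/-- Equivalent to the Mills bound `z * stdPdf z / (1 + z ^ 2) ≤ tail z`, whose two sides differ by a
function with derivative `-2 * stdPdf z / (1 + z ^ 2) ^ 2` and limit `0`. -/
lemma excess_le_stdPdf_div {z : ℝ} (hz : 0 ≤ z) : excess z ≤ stdPdf z / (1 + z ^ 2) := by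
  have h : 0 ≤ tail z - z * stdPdf z / (1 + z ^ 2) := by
    refine nonneg_of_deriv_nonpos_of_tendsto (f := fun z => tail z - z * stdPdf z / (1 + z ^ 2))
      (f' := fun x => -stdPdf x - ((1 * stdPdf x + x * (-x * stdPdf x)) * (1 + x ^ 2) -
        x * stdPdf x * (2 * x)) / (1 + x ^ 2) ^ 2)
      (fun x hx => ?_) (fun x hx => ?_) ?_ hz
    · have h1 : HasDerivAt (fun x : ℝ => 1 + x ^ 2) (2 * x) x := by
        simpa using (hasDerivAt_pow 2 x).const_add 1
      exact (hasDerivAt_tail x).sub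
        (((hasDerivAt_id x).mul (hasDerivAt_stdPdf x)).div h1 (by positivity))
    · have h1 : (0 : ℝ) < (1 + x ^ 2) ^ 2 := by positivity
      rw [sub_nonpos, le_div_iff₀ h1]
      nlinarith [stdPdf_pos x]
    · rw [← sub_zero (0 : ℝ)]
      refine tendsto_tail.sub (squeeze_zero' ?_ ?_ tendsto_stdPdf)
      · filter_upwards [eventually_ge_atTop 0] with x hx
        have := stdPdf_pos x
        positivity
      · filter_upwards [eventually_ge_atTop 0] with x hx
        rw [div_le_iff₀ (by positivity)]
        nlinarith [stdPdf_pos x, mul_nonneg (stdPdf_pos x).le (sq_nonneg (x - 1))]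
  have h1 : (0 : ℝ) < 1 + z ^ 2 := by positivity
  rw [sub_nonneg, div_le_iff₀ h1] at h
  rw [le_div_iff₀ h1, excess]
  nlinarith

/-! ### Numerical bounds for the normal distribution -/

lemma sqrt_two_pi_inv_lt : (√(2 * Real.pi))⁻¹ < 0.399 := by
  have h : (2.5064 : ℝ) < √(2 * Real.pi) := by
    apply Real.lt_sqrt_of_sq_lt; nlinarith [Real.pi_gt_d4]
  calc (√(2 * Real.pi))⁻¹ < (2.5064 : ℝ)⁻¹ := by gcongr
    _ < 0.399 := by norm_num

lemma lt_sqrt_two_pi_inv : 0.398 < (√(2 * Real.pi))⁻¹ := by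
  have h : √(2 * Real.pi) < 2.507 := by
    rw [Real.sqrt_lt' (by norm_num)]; nlinarith [Real.pi_lt_d4]
  calc (0.398 : ℝ) < (2.507 : ℝ)⁻¹ := by norm_num
    _ < _ := by gcongr

lemma stdPdf_le_mul_exp (x : ℝ) : stdPdf x ≤ 0.399 * Real.exp (-(x ^ 2 / 2)) := by
  unfold stdPdf; gcongr; exact sqrt_two_pi_inv_lt.le

lemma stdPdf_lt (x : ℝ) : stdPdf x < 0.399 := by
  have := sqrt_two_pi_inv_lt
  have h1 : Real.exp (-(x ^ 2 / 2)) ≤ 1 := Real.exp_le_one_iff.2 (by nlinarith [sq_nonneg x])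
  have h2 : 0 < (√(2 * Real.pi))⁻¹ := by positivity
  unfold stdPdf; nlinarith

lemma exp_neg_le_inv {x c : ℝ} (hx : 0 ≤ x) (hc : 0 < c)
    (h : c ≤ ∑ i ∈ Finset.range 8, x ^ i / i.factorial) : Real.exp (-x) ≤ c⁻¹ := by
  rw [Real.exp_neg]; gcongr; exact h.trans (Real.sum_le_exp_of_nonneg hx 8)

lemma stdPdf_point_eight : stdPdf 0.8 ≤ 0.29 := by
  -- Here `0.32 = 0.8 ^ 2 / 2`, and `1.377` is just below the Taylor sum of `exp 0.32`; the next
  -- three lemmas follow the same pattern.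
  have h : Real.exp (-0.32) ≤ (1.377)⁻¹ := exp_neg_le_inv (by norm_num) (by norm_num)
    (by norm_num [Finset.sum_range_succ, Nat.factorial])
  have := stdPdf_le_mul_exp 0.8
  norm_num at this h ⊢
  linarith

lemma stdPdf_one : stdPdf 1 ≤ 0.2425 := by
  have h : Real.exp (-0.5) ≤ (1.6485)⁻¹ := exp_neg_le_inv (by norm_num) (by norm_num)
    (by norm_num [Finset.sum_range_succ, Nat.factorial])
  have := stdPdf_le_mul_exp 1
  norm_num at this h ⊢
  linarith

lemma stdPdf_one_point_five : stdPdf 1.5 ≤ 0.1298 := by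
  have h : Real.exp (-1.125) ≤ (3.08)⁻¹ := exp_neg_le_inv (by norm_num) (by norm_num)
    (by norm_num [Finset.sum_range_succ, Nat.factorial])
  have := stdPdf_le_mul_exp 1.5
  norm_num at this h ⊢
  linarith

lemma stdPdf_one_point_eight : stdPdf 1.8 ≤ 0.08 := by
  have h : Real.exp (-1.62) ≤ (5.04)⁻¹ := exp_neg_le_inv (by norm_num) (by norm_num)
    (by norm_num [Finset.sum_range_succ, Nat.factorial])
  have := stdPdf_le_mul_exp 1.8
  norm_num at this h ⊢
  linarith

lemma mul_stdPdf_antitoneOn {a x : ℝ} (ha : 1 ≤ a) (hx : a ≤ x) :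
    x * stdPdf x ≤ a * stdPdf a := by
  have h : x ≤ a * Real.exp (x ^ 2 / 2 - a ^ 2 / 2) := by
    have := Real.add_one_le_exp (x ^ 2 / 2 - a ^ 2 / 2)
    nlinarith [mul_le_mul_of_nonneg_left this (by linarith : 0 ≤ a), mul_nonneg (sub_nonneg.2 hx)
      (by nlinarith : (0 : ℝ) ≤ a * (x + a) / 2 - 1)]
  have h2 : a * stdPdf a = a * Real.exp (x ^ 2 / 2 - a ^ 2 / 2) * stdPdf x := by
    rw [stdPdf, stdPdf, mul_assoc, mul_left_comm (Real.exp (x ^ 2 / 2 - a ^ 2 / 2)), ← Real.exp_add]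
    congr 3; ring
  rw [h2]
  exact mul_le_mul_of_nonneg_right h (stdPdf_pos x).le

lemma mul_stdPdf_le (x : ℝ) : x * stdPdf x ≤ 0.2425 := by
  have h : x ≤ Real.exp (x ^ 2 / 2 - 1 ^ 2 / 2) := by
    have := Real.add_one_le_exp (x ^ 2 / 2 - 1 ^ 2 / 2)
    nlinarith [sq_nonneg (x - 1)]
  have h2 : stdPdf 1 = Real.exp (x ^ 2 / 2 - 1 ^ 2 / 2) * stdPdf x := by
    rw [stdPdf, stdPdf, mul_left_comm (Real.exp (x ^ 2 / 2 - 1 ^ 2 / 2)), ← Real.exp_add]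
    congr 2; ring
  calc x * stdPdf x ≤ _ := mul_le_mul_of_nonneg_right h (stdPdf_pos x).le
    _ ≤ _ := h2 ▸ stdPdf_one

lemma mul_tail_le_stdPdf (z : ℝ) : z * tail z ≤ stdPdf z := by
  have := excess_nonneg z
  unfold excess at this; linarith

/-- Comparison of two functions at `z ≥ 0` through their derivatives and their values at `0`. -/
lemma le_of_deriv_le {f g f' g' : ℝ → ℝ} (hf : ∀ x, HasDerivAt f (f' x) x)
    (hg : ∀ x, HasDerivAt g (g' x) x) (h0 : f 0 ≤ g 0) (h : ∀ x, 0 ≤ x → f' x ≤ g' x) {z : ℝ}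
    (hz : 0 ≤ z) : f z ≤ g z :=
  image_le_of_deriv_right_le_deriv_boundary (a := 0) (b := z)
    (fun x _ => (hf x).continuousAt.continuousWithinAt) (fun x _ => (hf x).hasDerivWithinAt) h0
    (fun x _ => (hg x).continuousAt.continuousWithinAt) (fun x _ => (hg x).hasDerivWithinAt)
    (fun x hx => h x hx.1) ⟨hz, le_rfl⟩

lemma le_tail {z : ℝ} (hz : 0 ≤ z) : 1 / 2 - 0.399 * z ≤ tail z := by
  refine le_of_deriv_le (f := fun z => 1 / 2 - 0.399 * z) (f' := fun _ => -(0.399 * 1))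
    (fun x => ((hasDerivAt_id x).const_mul 0.399).const_sub _) hasDerivAt_tail
    (by simp [tail_zero]) (fun x _ => ?_) hz
  linarith [stdPdf_lt x]

/-- Integrates `stdPdf x ≥ 0.398 * (1 - x ^ 2 / 2)`, which comes from `exp y ≥ 1 + y`. -/
lemma tail_le {z : ℝ} (hz : 0 ≤ z) : tail z ≤ 1 / 2 - 0.398 * (z - z ^ 3 / 6) := by
  refine le_of_deriv_le (g := fun z => 1 / 2 - 0.398 * (z - z ^ 3 / 6))
    (g' := fun z => -(0.398 * (1 - 3 * z ^ 2 / 6))) hasDerivAt_tail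
    (fun x => (((hasDerivAt_id x).sub ((by simpa using hasDerivAt_pow 3 x :
      HasDerivAt (fun x : ℝ => x ^ 3) (3 * x ^ 2) x).div_const 6)).const_mul 0.398).const_sub _)
    (by simp [tail_zero]) (fun x _ => ?_) hz
  have h1 := Real.add_one_le_exp (-(x ^ 2 / 2))
  have h2 := lt_sqrt_two_pi_inv
  have h3 : 0.398 * Real.exp (-(x ^ 2 / 2)) ≤ stdPdf x := by unfold stdPdf; gcongr
  linarith

lemma excess_le {z : ℝ} (hz : 0 ≤ z) : excess z ≤ 0.399 - z / 2 + 0.1995 * z ^ 2 := by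
  refine le_of_deriv_le (g := fun z => 0.399 - z / 2 + 0.1995 * z ^ 2)
    (g' := fun z => -(1 / 2) + 0.1995 * (2 * z)) hasDerivAt_excess
    (fun x => (((hasDerivAt_id x).div_const 2).const_sub 0.399).add
      ((by simpa using hasDerivAt_pow 2 x :
        HasDerivAt (fun x : ℝ => x ^ 2) (2 * x) x).const_mul 0.1995))
    ?_ (fun x hx => ?_) hz
  · simp [excess]; have := stdPdf_lt 0; linarith
  · linarith [le_tail hx]

/-- In probabilistic terms, cutting a standard normal variable at `z` explains at most its whole
variance, the explained part being `stdPdf z ^ 2 / (tail z * tail (-z))`. The proof multiplies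
`stdPdf z ≤ (1 + z) * tail z` by `(1 + z) * stdPdf z ≤ tail (-z)`. -/
lemma stdPdf_sq_le (z : ℝ) : stdPdf z ^ 2 ≤ tail z * tail (-z) := by
  wlog hz : 0 ≤ z generalizing z
  · have := this (-z) (by linarith)
    rwa [stdPdf_neg, neg_neg, mul_comm] at this
  have h1 : tail z ≤ 1 / 2 - z * stdPdf z := by
    refine le_of_deriv_le (g := fun z => 1 / 2 - z * stdPdf z)
      (g' := fun x => -(1 * stdPdf x + x * (-x * stdPdf x))) hasDerivAt_tail
      (fun x => ((hasDerivAt_id x).mul (hasDerivAt_stdPdf x)).const_sub _)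
      (by simp [tail_zero]) (fun x _ => ?_) hz
    nlinarith [stdPdf_pos x, mul_nonneg (sq_nonneg x) (stdPdf_pos x).le]
  have h2 := stdPdf_le_one_add_mul_tail hz
  have h3 : (1 + z) * stdPdf z ≤ tail (-z) := by
    rw [tail_neg]; linarith [stdPdf_lt z]
  have h4 := mul_le_mul h2 h3 (mul_nonneg (by linarith) (stdPdf_pos z).le)
    (mul_nonneg (by linarith) (tail_nonneg z))
  have h5 : 0 < 1 + z := by linarith
  nlinarith [h4]

/-! ### The balance equation on the line -/

/-- At a balanced threshold, the nearer class mean is at least `0.8` standard deviations away. -/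
lemma point_eight_le_of_balanced {r A b : ℝ} (hr1 : 1 / 2 ≤ r) (hr2 : r ≤ 2) (hb : 0 < b)
    (hbA : b ≤ A) (hD : 1.5 * (1 + r) ≤ r * A + b)
    (hz : r * A - b = (r * A + b + 2 * (excess b + r * excess A)) * (tail b - tail A)) :
    0.8 ≤ b := by
  -- From `b ≤ A`: `(1 + r) * A ≥ r * A + b ≥ 1.5 * (1 + r)`.
  have hA : 1.5 ≤ A := by nlinarith
  have e1 : excess A ≤ 0.04 := by
    refine (excess_antitone hA).trans ((excess_le_stdPdf_div (by norm_num)).trans ?_)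
    rw [div_le_iff₀ (by norm_num)]
    linarith [stdPdf_one_point_five]
  have e2 : r * excess A ≤ 0.08 := by nlinarith [excess_nonneg A]
  have e0 := mul_nonneg (by linarith : 0 ≤ r) (excess_nonneg A)
  by_contra! hlt
  have hL := excess_le hb.le
  have hQ := tail_le hb.le
  -- On `[0, 0.8]` the polynomial bounds lie below these chords. The balance equation then becomes a
  -- quadratic inequality in `b` that fails on the whole interval.
  have hQ' : tail b ≤ 1 / 2 - 0.355 * b := by nlinarith [mul_pos hb hb]
  have hL' : excess b ≤ 0.399 - 0.34 * b := by nlinarith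
  have hLb := excess_nonneg b
  have hS : excess b + r * excess A ≤ 0.479 - 0.34 * b := by linarith
  have h1 : r * A - b ≤ (r * A + b + 2 * (excess b + r * excess A)) * tail b := by
    rw [hz]
    refine mul_le_mul_of_nonneg_left (by linarith [tail_pos A]) ?_
    nlinarith
  have h2 : 2.25 * (1 / 2 + 0.355 * b) ≤ (r * A + b) * (1 - tail b) :=
    mul_le_mul (by nlinarith) (by linarith) (by positivity) (by nlinarith)
  have h3 : (excess b + r * excess A) * tail b ≤ (0.479 - 0.34 * b) * (1 / 2 - 0.355 * b) :=
    mul_le_mul hS hQ' (tail_nonneg b) (by linarith)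
  nlinarith

/-- The slope of the balance equation is positive at a balanced threshold. -/
lemma slope_pos_of_balanced {r A b : ℝ} (hr1 : 1 / 2 ≤ r) (hr2 : r ≤ 2) (hb : 0 < b)
    (hbA : b ≤ A) (hD : 1.5 * (1 + r) ≤ r * A + b)
    (hz : r * A - b = (r * A + b + 2 * (excess b + r * excess A)) * (tail b - tail A)) :
    (r * A + b + 2 * (excess b + r * excess A)) * (stdPdf b + stdPdf A / r) +
      2 * (tail b - tail A) ^ 2 < 2 := by
  have hb8 := point_eight_le_of_balanced hr1 hr2 hb hbA hD hz
  have hA : 1.5 ≤ A := by nlinarith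
  have e1 : excess A ≤ 0.04 := by
    refine (excess_antitone hA).trans ((excess_le_stdPdf_div (by norm_num)).trans ?_)
    rw [div_le_iff₀ (by norm_num)]
    linarith [stdPdf_one_point_five]
  have e2 : r * excess A ≤ 0.08 := by nlinarith [excess_nonneg A]
  have e0 := mul_nonneg (by linarith : 0 ≤ r) (excess_nonneg A)
  have hLb := excess_nonneg b
  set S := excess b + r * excess A with hS
  have hQA := tail_pos A
  have hQ1 : tail A ≤ tail b := tail_strictAnti.antitone hbA
  have hrp : 0 < r := by linarith
  have hφA : stdPdf A / r ≤ 0.26 := by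
    rw [div_le_iff₀ hrp]
    nlinarith [stdPdf_anti (by norm_num) hA, stdPdf_one_point_five]
  have hφA0 : 0 ≤ stdPdf A / r := div_nonneg (stdPdf_pos A).le hrp.le
  have hbφA : b * (stdPdf A / r) ≤ 0.39 := by
    rw [mul_div_assoc', div_le_iff₀ hrp]
    nlinarith [mul_stdPdf_antitoneOn (by norm_num) hA, stdPdf_one_point_five, stdPdf_pos A]
  have hbφ := mul_stdPdf_le b
  have hφb := stdPdf_pos b
  set w := stdPdf b + stdPdf A / r with hw
  have hw0 : 0 < w := by positivity
  have hDpos : 0 < r * A + b + 2 * S := by nlinarith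
  -- The separation has no upper bound; the balance equation trades it for the nearer distance `b`.
  have h1 : (r * A + b + 2 * S) * (1 - tail b) ≤ 2 * (b + S) := by
    have : (r * A + b + 2 * S) * (tail b - tail A) ≤ (r * A + b + 2 * S) * tail b :=
      mul_le_mul_of_nonneg_left (by linarith) hDpos.le
    nlinarith
  have hq : (tail b - tail A) ^ 2 ≤ tail b ^ 2 := by
    apply pow_le_pow_left₀ <;> linarith
  -- Multiplied by `p`, the left side is at most `2 * c + 2 * (1 - p) ^ 2 * p`. The values of `p`
  -- below come from `tail_le` at `0.8` and at `1`, the left ends of the two ranges of `b`.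
  suffices h : ∃ p c : ℝ, 0 < p ∧ tail b ≤ 1 - p ∧ (b + S) * w ≤ c ∧ c + (1 - p) ^ 2 * p < p by
    obtain ⟨p, c, hp, hp1, hc, hlt⟩ := h
    have h2 : (r * A + b + 2 * S) * w * p ≤ 2 * c := by
      calc (r * A + b + 2 * S) * w * p ≤ (r * A + b + 2 * S) * w * (1 - tail b) := by
            apply mul_le_mul_of_nonneg_left (by linarith); positivity
        _ = (r * A + b + 2 * S) * (1 - tail b) * w := by ring
        _ ≤ 2 * (b + S) * w := mul_le_mul_of_nonneg_right h1 hw0.le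
        _ ≤ 2 * c := by linarith
    have h3 : tail b ^ 2 ≤ (1 - p) ^ 2 := by
      apply pow_le_pow_left₀ (tail_nonneg b) hp1
    have h4 : ((r * A + b + 2 * S) * w + 2 * (tail b - tail A) ^ 2) * p < 2 * p := by
      nlinarith
    exact lt_of_mul_lt_mul_right h4 hp.le
  rcases le_total b 1 with hb1 | hb1
  · refine ⟨0.784, 0.6175, by norm_num, ?_, ?_, by norm_num⟩
    · have := tail_strictAnti.antitone hb8
      have h5 := tail_le (z := 0.8) (by norm_num)
      norm_num at h5 this ⊢
      linarith
    · have h5 := excess_antitone hb8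
      have h6 := excess_le (z := 0.8) (by norm_num)
      have h7 := (stdPdf_anti (by norm_num) hb8).trans stdPdf_point_eight
      have h8 : S ≤ 0.2077 := by norm_num at h5 h6 ⊢; linarith
      have h9 : S * w ≤ 0.2077 * 0.55 :=
        mul_le_mul h8 (by linarith) hw0.le (by norm_num)
      have h10 : b * (stdPdf A / r) ≤ 1 * 0.26 := mul_le_mul hb1 hφA hφA0 (by norm_num)
      have h11 : (b + S) * w = b * stdPdf b + b * (stdPdf A / r) + S * w := by rw [hw]; ring
      rw [h11]; linarith
  · refine ⟨0.83, 0.7235, by norm_num, ?_, ?_, by norm_num⟩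
    · have := tail_strictAnti.antitone hb1
      have h5 := tail_le (z := 1) (by norm_num)
      norm_num at h5 this ⊢
      linarith
    · have h5 := excess_antitone hb1
      have h6 := excess_le (z := 1) (by norm_num)
      have h7 := (stdPdf_anti (by norm_num) hb1).trans stdPdf_one
      have h8 : S ≤ 0.179 := by norm_num at h5 h6 ⊢; linarith
      have h9 : S * w ≤ 0.179 * 0.5025 :=
        mul_le_mul h8 (by linarith) hw0.le (by norm_num)
      have h11 : (b + S) * w = b * stdPdf b + b * (stdPdf A / r) + S * w := by rw [hw]; ring
      rw [h11]; linarith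

/-- The balance function: it vanishes at the threshold `t` exactly when `t` is the midpoint of the
two cluster means of the mixture of `N(0, r²)` and `N(D, 1)` cut at `t`. -/
noncomputable def balance (r D t : ℝ) : ℝ :=
  2 * t - D - (D + 2 * (r * excess (t / r) + excess (D - t))) * (tail (D - t) - tail (t / r))

lemma hasDerivAt_balance {r D t : ℝ} (hr : 0 < r) :
    HasDerivAt (balance r D)
      (2 - ((D + 2 * (r * excess (t / r) + excess (D - t))) * (stdPdf (D - t) + stdPdf (t / r) / r)
        + 2 * (tail (D - t) - tail (t / r)) ^ 2)) t := by
  have h1 : HasDerivAt (fun t => t / r) (1 / r) t := (hasDerivAt_id t).div_const r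
  have h2 : HasDerivAt (fun t => D - t) (-1) t := (hasDerivAt_id t).const_sub D
  have e1 := (hasDerivAt_excess (t / r)).comp t h1
  have e2 := (hasDerivAt_excess (D - t)).comp t h2
  have t1 := (hasDerivAt_tail (t / r)).comp t h1
  have t2 := (hasDerivAt_tail (D - t)).comp t h2
  convert! (((hasDerivAt_id t).const_mul 2).sub_const D).sub
    ((((e1.const_mul r).add e2).const_mul 2).const_add D |>.mul (t2.sub t1)) using 1
  simp only [Function.comp_apply, Pi.add_apply, Pi.sub_apply]
  field_simp
  ring

/-- `slope_pos_of_balanced` assumes that the second class is the nearer one in standard units. In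
the other case, exchange the classes and rescale, which replaces `r` by `r⁻¹`; hence the range `[1 /
2, 2]` there. -/
lemma balance_slope_pos {r D t : ℝ} (hr1 : 1 / 2 ≤ r) (hr2 : r ≤ 1) (hD : 1.5 * (1 + r) ≤ D)
    (ht : 0 < t) (htD : t < D) (hz : balance r D t = 0) :
    0 < 2 - ((D + 2 * (r * excess (t / r) + excess (D - t))) *
      (stdPdf (D - t) + stdPdf (t / r) / r) + 2 * (tail (D - t) - tail (t / r)) ^ 2) := by
  have hr : 0 < r := by linarith
  obtain ⟨A, rfl⟩ : ∃ A, t = r * A := ⟨t / r, by field_simp⟩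
  obtain ⟨b, rfl⟩ : ∃ b, D = r * A + b := ⟨D - r * A, by ring⟩
  have hb : 0 < b := by linarith
  have hA : 0 < A := by nlinarith
  have hAr : r * A / r = A := by field_simp
  have hbr : r * A + b - r * A = b := by ring
  unfold balance at hz
  rw [hAr, hbr] at hz ⊢
  rcases le_total b A with h | h
  · have := slope_pos_of_balanced hr1 (by linarith) hb h hD (by linarith)
    rw [add_comm (excess b)] at this
    linarith
  · have h2 : 1 / 2 ≤ r⁻¹ := by rw [le_inv_comm₀ (by norm_num) hr]; linarith
    have h3 : r⁻¹ ≤ 2 := by rw [inv_le_comm₀ hr (by norm_num)]; linarith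
    have h4 : 1.5 * (1 + r⁻¹) ≤ r⁻¹ * b + A := by
      rw [← mul_le_mul_iff_right₀ hr]; field_simp; linarith
    have := slope_pos_of_balanced h2 h3 hA h h4 (by field_simp; linarith)
    have e : (r⁻¹ * b + A + 2 * (excess A + r⁻¹ * excess b)) * (stdPdf A + stdPdf b / r⁻¹) =
        (r * A + b + 2 * (r * excess A + excess b)) * (stdPdf b + stdPdf A / r) := by
      field_simp; ring
    rw [e] at this
    nlinarith

/-- A function that crosses each of its zeros upwards cannot come back to zero: a later zero of
positive slope would need negative values just before it. -/
lemma balance_pos_of_nonneg_of_lt {r D x y : ℝ} (hr1 : 1 / 2 ≤ r) (hr2 : r ≤ 1)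
    (hD : 1.5 * (1 + r) ≤ D) (hx : 0 < x) (hxy : x < y) (hy : y < D) (h : 0 ≤ balance r D x) :
    0 < balance r D y := by
  have hr : 0 < r := by linarith
  have hd := fun t => hasDerivAt_balance (D := D) (t := t) hr
  have hnn : ∀ ⦃w⦄, w ∈ Icc x y → -balance r D w ≤ 0 := by
    refine image_le_of_deriv_right_lt_deriv_boundary
      (fun w _ => (hd w).neg.continuousAt.continuousWithinAt)
      (fun w _ => (hd w).neg.hasDerivWithinAt) (B := fun _ => 0) (B' := fun _ => 0) (by simpa)
      (fun w => hasDerivAt_const w _) fun w hw hw0 => ?_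
    have := balance_slope_pos hr1 hr2 hD (hx.trans_le hw.1) (hw.2.trans hy) (neg_eq_zero.1 hw0)
    linarith
  have hy0 : 0 ≤ balance r D y := by linarith [hnn ⟨hxy.le, le_rfl⟩]
  refine hy0.lt_of_ne' fun h0 => ?_
  have hpos := balance_slope_pos hr1 hr2 hD (hx.trans hxy) hy h0
  have hs := (hasDerivAt_iff_tendsto_slope.1 (hd y)).mono_left (nhdsLT_le_nhdsNE y)
  have h1 := hs.eventually (eventually_gt_nhds hpos)
  obtain ⟨w, hw, hxw, hwy⟩ := (h1.and (Ioo_mem_nhdsLT hxy)).exists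
  have h2 := hnn ⟨hxw.le, hwy.le⟩
  rw [slope_def_field, h0, sub_zero] at hw
  exact absurd hw (not_lt.2 (div_nonpos_of_nonneg_of_nonpos (by linarith) (by linarith)))

/-- At the midpoint of the class means the wider second class spills over more than the first, so
`balance` is negative there, whereas it would be nonnegative had a zero occurred by then. -/
lemma half_lt_of_balance_eq_zero {r D t : ℝ} (hr1 : 1 / 2 ≤ r) (hr2 : r < 1)
    (hD : 1.5 * (1 + r) ≤ D) (ht : 0 < t) (htD : t < D) (hz : balance r D t = 0) :
    D / 2 < t := by
  have hr : 0 < r := by linarith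
  have hDp : 0 < D := by linarith
  have hneg : balance r D (D / 2) < 0 := by
    have h1 : D / 2 < D / 2 / r := by rw [lt_div_iff₀ hr]; nlinarith
    have h2 := tail_strictAnti h1
    have h3 := excess_nonneg (D / 2 / r)
    have h4 := excess_nonneg (D / 2)
    unfold balance
    rw [show D - D / 2 = D / 2 by ring]
    have : 0 < (D + 2 * (r * excess (D / 2 / r) + excess (D / 2))) *
        (tail (D / 2) - tail (D / 2 / r)) := mul_pos (by positivity) (by linarith)
    linarith
  by_contra! hle
  rcases hle.eq_or_lt with rfl | hlt
  · linarith
  · have := balance_pos_of_nonneg_of_lt hr1 hr2.le hD ht hlt (by linarith) hz.ge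
    linarith

/-- The factor `stdPdf (t / r)` comes out because `r * excess (t / r)` has `r`-derivative exactly
`stdPdf (t / r)`. -/
lemma hasDerivAt_balance_scale {r D t : ℝ} (hr : 0 < r) :
    HasDerivAt (fun r => balance r D t)
      (stdPdf (t / r) * ((D + 2 * (r * excess (t / r) + excess (D - t))) * (t / r ^ 2) -
        2 * (tail (D - t) - tail (t / r)))) r := by
  have h1 : HasDerivAt (fun r => t / r) (-t / r ^ 2) r := by
    convert! (hasDerivAt_const r t).div (hasDerivAt_id r) hr.ne' using 1
    simp
  have e1 := (hasDerivAt_excess (t / r)).comp r h1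
  have t1 := (hasDerivAt_tail (t / r)).comp r h1
  convert! (((((hasDerivAt_id r).mul e1).add_const (excess (D - t))).const_mul 2).const_add D
    |>.mul (t1.const_sub (tail (D - t)))).const_sub (2 * t - D) using 1
  simp only [Function.comp_apply, Pi.mul_apply, excess, id]
  field_simp
  ring

lemma balance_scale_lt {r r' D t : ℝ} (hr : 0 < r) (hrr : r < r') (hr' : r' ≤ 1)
    (hD : 2 ≤ D) (ht : D / 2 ≤ t) (htD : t < D) : balance r D t < balance r' D t := by
  have hcont : ContinuousOn (fun r => balance r D t) (Icc r r') := fun x hx =>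
    (hasDerivAt_balance_scale (hr.trans_le hx.1)).continuousAt.continuousWithinAt
  refine strictMonoOn_of_deriv_pos (convex_Icc r r') hcont (fun x hx => ?_) ⟨le_rfl, hrr.le⟩
    ⟨hrr.le, le_rfl⟩ hrr
  rw [interior_Icc] at hx
  have hx0 : 0 < x := hr.trans hx.1
  rw [(hasDerivAt_balance_scale hx0).deriv]
  have h1 : tail (D - t) ≤ 1 / 2 := tail_zero ▸ tail_strictAnti.antitone (by linarith)
  have h2 := tail_pos (t / x)
  have h3 := mul_nonneg hx0.le (excess_nonneg (t / x))
  have h4 := excess_nonneg (D - t)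
  -- Then the first term is at least `D ≥ 2`, while the subtracted one is below `1`.
  have h5 : 1 ≤ t / x ^ 2 := by
    rw [le_div_iff₀ (by positivity)]; nlinarith [hx.2]
  exact mul_pos (stdPdf_pos _) (by nlinarith)

/-- The balanced threshold decreases when the first standard deviation grows. -/
lemma balanced_threshold_lt {r r' D t t' : ℝ} (hr : 1 / 2 ≤ r) (hrr : r < r') (hr' : r' < 1)
    (hD : 1.5 * (1 + r') ≤ D) (ht : 0 < t) (htD : t < D) (hz : balance r D t = 0)
    (ht' : 0 < t') (htD' : t' < D) (hz' : balance r' D t' = 0) : t' < t := by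
  have h1 := half_lt_of_balance_eq_zero hr (hrr.trans hr') (by linarith) ht htD hz
  have h2 := balance_scale_lt (D := D) (t := t) (by linarith) hrr hr'.le (by linarith) h1.le htD
  by_contra! hle
  rcases hle.eq_or_lt with rfl | hlt
  · linarith
  · have := balance_pos_of_nonneg_of_lt (by linarith) hr'.le hD ht hlt htD' (by linarith)
    linarith

lemma tail_one_point_eight_lt : tail 1.8 < 0.05 := by
  have h1 := mul_tail_le_stdPdf 1.8
  have h2 := stdPdf_one_point_eight
  norm_num at h1 h2 ⊢
  linarith

/-- The first class is far since `t > D / 2`. For the second, `D ≥ 4.5` and the balance equation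
give `4.5 * (1 - tail b) ≤ 2 * b` up to a small excess term, which fails for `b < 1.8`. -/
lemma tail_lt_of_balance_eq_zero {r D t : ℝ} (hr1 : 1 / 2 ≤ r) (hr2 : r < 1)
    (hD : 3 * (1 + r) ≤ D) (ht : 0 < t) (htD : t < D) (hz : balance r D t = 0) :
    tail (t / r) < 0.05 ∧ tail (D - t) < 0.05 := by
  have hr : 0 < r := by linarith
  have h1 := half_lt_of_balance_eq_zero hr1 hr2 (by linarith) ht htD hz
  obtain ⟨A, rfl⟩ : ∃ A, t = r * A := ⟨t / r, by field_simp⟩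
  obtain ⟨b, rfl⟩ : ∃ b, D = r * A + b := ⟨D - r * A, by ring⟩
  have hb : 0 < b := by linarith
  have hAr : r * A / r = A := by field_simp
  have hbr : r * A + b - r * A = b := by ring
  unfold balance at hz
  rw [hAr, hbr] at hz ⊢
  have hA : 1.8 ≤ A := by nlinarith
  have hbA : b ≤ A := by nlinarith
  refine ⟨(tail_strictAnti.antitone hA).trans_lt tail_one_point_eight_lt, ?_⟩
  suffices h : 1.8 ≤ b from (tail_strictAnti.antitone h).trans_lt tail_one_point_eight_lt
  have hz2 : r * A - b = (r * A + b + 2 * (excess b + r * excess A)) * (tail b - tail A) := by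
    rw [add_comm (excess b)]; linarith
  have hb8 := point_eight_le_of_balanced hr1 (by linarith) hb hbA (by linarith) hz2
  have e1 : excess A ≤ 0.04 := by
    refine (excess_antitone (by linarith : 1.5 ≤ A)).trans
      ((excess_le_stdPdf_div (by norm_num)).trans ?_)
    rw [div_le_iff₀ (by norm_num)]
    linarith [stdPdf_one_point_five]
  have e2 : r * excess A ≤ 0.08 := by nlinarith [excess_nonneg A]
  have e0 := mul_nonneg (by linarith : 0 ≤ r) (excess_nonneg A)
  have hLb := excess_nonneg b
  have hTA := tail_pos A
  have hTb := tail_pos b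
  have h2 : (r * A + b) * (1 - tail b) ≤ 2 * b + 2 * (excess b + r * excess A) * tail b := by
    nlinarith [mul_nonneg (by nlinarith : 0 ≤ r * A + b + 2 * (excess b + r * excess A)) hTA.le]
  by_contra! hlt
  rcases le_total b 1 with hb1 | hb1
  · have h3 := tail_strictAnti.antitone hb8
    have h4 := tail_le (z := 0.8) (by norm_num)
    have h5 := excess_antitone hb8
    have h6 := excess_le (z := 0.8) (by norm_num)
    norm_num at h3 h4 h5 h6
    nlinarith
  · have h3 := tail_strictAnti.antitone hb1
    have h4 := tail_le (z := 1) (by norm_num)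
    have h5 := excess_antitone hb1
    have h6 := excess_le (z := 1) (by norm_num)
    norm_num at h3 h4 h5 h6
    nlinarith

/-- If the threshold is the midpoint of the two cluster means, then it lies between the class means
and is balanced. -/
lemma balanced_of_midpoint {r A b : ℝ} (hr : 0 < r) (hr1 : r ≤ 1) (hD : 2 < r * A + b)
    (h : (r * excess A + excess (-b)) * (tail (-A) + tail b) =
      (r * excess (-A) + excess b) * (tail A + tail (-b))) :
    0 < A ∧ 0 < b ∧ balance r (r * A + b) (r * A) = 0 := by
  -- A threshold on the outer side of both class means is impossible: the outer cluster mean is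
  -- within `1` of it by `excess_le_tail`, while the inner side has total excess above `2` on mass
  -- below `2`, so its mean is farther than `1`.
  have key : ∀ {r₁ r₂ a c : ℝ}, 0 < r₁ → r₁ ≤ 1 → 0 < r₂ → r₂ ≤ 1 → 0 ≤ a → 0 ≤ c → 2 < r₁ * a →
      (r₁ * excess a + r₂ * excess c) * (tail (-a) + tail (-c)) ≠
        (r₁ * excess (-a) + r₂ * excess (-c)) * (tail a + tail c) := by
    intro r₁ r₂ a c h1 h1' h2 h2' ha hc hac heq
    have e1 := excess_le_tail ha
    have e2 := excess_le_tail hc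
    have p1 := tail_pos a
    have p2 := tail_pos c
    have n1 := excess_nonneg a
    have n2 := excess_nonneg c
    rw [tail_neg, tail_neg, excess_neg, excess_neg] at heq
    have l1 : r₁ * excess a + r₂ * excess c ≤ tail a + tail c := by nlinarith
    have l2 : 2 < r₁ * (excess a + a) + r₂ * (excess c + c) := by
      nlinarith [mul_nonneg h1.le n1, mul_nonneg h2.le n2, mul_nonneg h2.le hc]
    have l3 : (r₁ * excess a + r₂ * excess c) * (1 - tail a + (1 - tail c)) ≤
        (tail a + tail c) * 2 :=
      mul_le_mul l1 (by linarith) (by linarith [tail_lt_one a, tail_lt_one c]) (by linarith)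
    nlinarith
  have hA : 0 < A := by
    by_contra! hA
    have := @key 1 r b (-A) one_pos le_rfl hr hr1 (by nlinarith) (by linarith) (by nlinarith)
    rw [neg_neg] at this
    apply this
    linarith
  have hb : 0 < b := by
    by_contra! hb
    have := @key r 1 A (-b) hr hr1 one_pos le_rfl hA.le (by linarith) (by nlinarith)
    rw [neg_neg] at this
    apply this
    linarith
  refine ⟨hA, hb, ?_⟩
  unfold balance
  rw [show r * A / r = A by field_simp, show r * A + b - r * A = b by ring]
  rw [tail_neg, tail_neg, excess_neg, excess_neg] at h
  linarith

/-! ### Halfspace integrals of the standard Gaussian -/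

section StdGaussian

variable {d : ℕ}

lemma sphericalGaussian_eq_map (m : EuclideanSpace ℝ (Fin d)) (s : ℝ) :
    sphericalGaussian m s =
      (stdGaussian (EuclideanSpace ℝ (Fin d))).map (fun x => m + s • x) := by
  rw [show (fun x => m + s • x) = (fun x : EuclideanSpace ℝ (Fin d) => m + x) ∘ (fun x => s • x)
    from rfl, ← Measure.map_map (by fun_prop) (by fun_prop)]
  have : IsProbabilityMeasure (sphericalGaussian m s) := by
    unfold sphericalGaussian; infer_instance
  have : IsProbabilityMeasure ((stdGaussian (EuclideanSpace ℝ (Fin d))).map (fun x => s • x)) :=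
    Measure.isProbabilityMeasure_map (by fun_prop)
  have : IsProbabilityMeasure (((stdGaussian (EuclideanSpace ℝ (Fin d))).map
      (fun x => s • x)).map (fun x => m + x)) :=
    Measure.isProbabilityMeasure_map (by fun_prop)
  apply Measure.ext_of_charFun
  ext x
  rw [sphericalGaussian, charFun_multivariateGaussian (Matrix.PosSemidef.one.smul (sq_nonneg s)),
    charFun_map_const_add, charFun_map_smul, charFun_stdGaussian, ← Complex.exp_add]
  congr 1
  have : x.ofLp ⬝ᵥ x.ofLp = ‖x‖ ^ 2 := by
    rw [EuclideanSpace.real_norm_sq_eq, dotProduct]; simp [sq]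
  rw [Matrix.smul_mulVec, Matrix.one_mulVec, dotProduct_smul, this, ← Complex.ofReal_pow, norm_smul,
    mul_pow, Real.norm_eq_abs, sq_abs, real_inner_comm]
  push_cast
  simp
  ring

instance {m : EuclideanSpace ℝ (Fin d)} {s : ℝ} : IsGaussian (sphericalGaussian m s) := by
  unfold sphericalGaussian; infer_instance

lemma integral_sphericalGaussian {F : Type*} [NormedAddCommGroup F] [NormedSpace ℝ F]
    (m : EuclideanSpace ℝ (Fin d)) {s : ℝ} (hs : s ≠ 0) (f : EuclideanSpace ℝ (Fin d) → F) :
    ∫ x, f x ∂(sphericalGaussian m s) = ∫ x, f (m + s • x) ∂(stdGaussian _) := by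
  rw [sphericalGaussian_eq_map]
  exact ((measurableEmbedding_addLeft m).comp (measurableEmbedding_const_smul₀ hs)).integral_map f

lemma map_inner_stdGaussian {u : EuclideanSpace ℝ (Fin d)} (hu : ‖u‖ = 1) :
    (stdGaussian (EuclideanSpace ℝ (Fin d))).map (fun x => ⟪u, x⟫) = gaussianReal 0 1 := by
  have h := IsGaussian.map_eq_gaussianReal (μ := stdGaussian (EuclideanSpace ℝ (Fin d)))
    (innerSL ℝ u)
  rw [integral_strongDual_stdGaussian, variance_dual_stdGaussian, innerSL_apply_norm, hu] at h
  simpa using h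

lemma stdGaussian_halfspace {u : EuclideanSpace ℝ (Fin d)} (hu : ‖u‖ = 1) (z : ℝ) :
    (stdGaussian (EuclideanSpace ℝ (Fin d))).real {x | z < ⟪u, x⟫} = tail z := by
  rw [tail, ← map_inner_stdGaussian hu, map_measureReal_apply (by fun_prop) measurableSet_Ioi]
  rfl

lemma stdGaussian_halfspace_excess {u : EuclideanSpace ℝ (Fin d)} (hu : ‖u‖ = 1) (z : ℝ) :
    ∫ x in {x | z < ⟪u, x⟫}, (⟪u, x⟫ - z) ∂(stdGaussian (EuclideanSpace ℝ (Fin d))) =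
      excess z := by
  rw [← setIntegral_sub_gaussianReal, ← map_inner_stdGaussian hu,
    setIntegral_map measurableSet_Ioi (by fun_prop) (by fun_prop)]
  rfl

/-- The reflection that sends `w` to `-w` preserves the Gaussian and the halfspace, and changes the
sign of the integrand. -/
lemma stdGaussian_halfspace_orthogonal {u w : EuclideanSpace ℝ (Fin d)} (huw : ⟪u, w⟫ = 0)
    (z : ℝ) : ∫ x in {x | z < ⟪u, x⟫}, ⟪w, x⟫ ∂(stdGaussian (EuclideanSpace ℝ (Fin d))) = 0 := by
  set ρ := (ℝ ∙ w)ᗮ.reflection with hρ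
  have hmp : MeasurePreserving ρ (stdGaussian (EuclideanSpace ℝ (Fin d)))
      (stdGaussian (EuclideanSpace ℝ (Fin d))) := ⟨ρ.continuous.measurable, stdGaussian_map ρ⟩
  have hw : ∀ x, ⟪w, ρ x⟫ = -⟪w, x⟫ := fun x => by
    rw [← ρ.inner_map_map w (ρ x), Submodule.reflection_reflection,
      Submodule.reflection_orthogonalComplement_singleton_eq_neg, inner_neg_left]
  have hu : ∀ x, ⟪u, ρ x⟫ = ⟪u, x⟫ := fun x => by
    rw [← ρ.inner_map_map u (ρ x), Submodule.reflection_reflection,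
      Submodule.reflection_mem_subspace_eq_self]
    rwa [Submodule.mem_orthogonal_singleton_iff_inner_left]
  have h := hmp.setIntegral_preimage_emb ρ.toHomeomorph.measurableEmbedding
    (fun x => ⟪w, x⟫) {x | z < ⟪u, x⟫}
  simp only [preimage_ofPred_eq, hu, hw, integral_neg] at h
  linarith

end StdGaussian

/-! ### Halfspace integrals of spherical Gaussians -/

section SphericalGaussian

variable {d : ℕ} {m u : EuclideanSpace ℝ (Fin d)} {s : ℝ}

lemma integrable_norm_sq_sphericalGaussian (m : EuclideanSpace ℝ (Fin d)) (s : ℝ) :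
    Integrable (fun x => ‖x‖ ^ 2) (sphericalGaussian m s) :=
  (IsGaussian.memLp_two_id (μ := sphericalGaussian m s)).integrable_norm_pow two_ne_zero

lemma integrable_id_sphericalGaussian (m : EuclideanSpace ℝ (Fin d)) (s : ℝ) :
    Integrable (fun x => x) (sphericalGaussian m s) := IsGaussian.integrable_fun_id

lemma integral_id_sphericalGaussian (m : EuclideanSpace ℝ (Fin d)) (s : ℝ) :
    ∫ x, x ∂(sphericalGaussian m s) = m := by
  unfold sphericalGaussian; simp

lemma lt_inner_add_smul_iff (hs : 0 < s) (x : EuclideanSpace ℝ (Fin d)) (τ : ℝ) :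
    τ < ⟪u, m + s • x⟫ ↔ (τ - ⟪u, m⟫) / s < ⟪u, x⟫ := by
  rw [inner_add_right, real_inner_smul_right, div_lt_iff₀ hs]
  constructor <;> intro h <;> linarith

lemma measurableSet_halfspace (u : EuclideanSpace ℝ (Fin d)) (τ : ℝ) :
    MeasurableSet {x : EuclideanSpace ℝ (Fin d) | τ < ⟪u, x⟫} :=
  measurableSet_lt measurable_const (by fun_prop)

lemma setIntegral_sphericalGaussian_halfspace {F : Type*} [NormedAddCommGroup F] [NormedSpace ℝ F]
    (hs : 0 < s) (τ : ℝ) (f : EuclideanSpace ℝ (Fin d) → F) :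
    ∫ x in {x | τ < ⟪u, x⟫}, f x ∂(sphericalGaussian m s) =
      ∫ x in {x | (τ - ⟪u, m⟫) / s < ⟪u, x⟫}, f (m + s • x) ∂(stdGaussian _) := by
  rw [← integral_indicator (measurableSet_halfspace u τ), integral_sphericalGaussian m hs.ne',
    ← integral_indicator (measurableSet_halfspace u _)]
  congr 1 with x
  by_cases h : τ < ⟪u, m + s • x⟫
  · rw [indicator_of_mem (by exact h),
      indicator_of_mem (by exact (lt_inner_add_smul_iff hs x τ).1 h)]
  · rw [indicator_of_notMem (by exact h),
      indicator_of_notMem (by exact fun h' => h ((lt_inner_add_smul_iff hs x τ).2 h'))]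

lemma sphericalGaussian_halfspace (hu : ‖u‖ = 1) (hs : 0 < s) (τ : ℝ) :
    (sphericalGaussian m s).real {x | τ < ⟪u, x⟫} = tail ((τ - ⟪u, m⟫) / s) := by
  have := setIntegral_sphericalGaussian_halfspace (m := m) (u := u) hs τ (fun _ => (1 : ℝ))
  simpa [stdGaussian_halfspace hu] using this

lemma sphericalGaussian_halfspace_excess (hu : ‖u‖ = 1) (hs : 0 < s) (τ : ℝ) :
    ∫ x in {x | τ < ⟪u, x⟫}, (⟪u, x⟫ - τ) ∂(sphericalGaussian m s) =
      s * excess ((τ - ⟪u, m⟫) / s) := by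
  rw [setIntegral_sphericalGaussian_halfspace hs, ← stdGaussian_halfspace_excess hu,
    ← integral_const_mul]
  congr 1 with x
  rw [inner_add_right, real_inner_smul_right]
  field_simp
  ring

lemma sphericalGaussian_halfspace_orthogonal (hu : ‖u‖ = 1) (hs : 0 < s) (τ : ℝ)
    {w : EuclideanSpace ℝ (Fin d)} (huw : ⟪u, w⟫ = 0) :
    ∫ x in {x | τ < ⟪u, x⟫}, ⟪w, x⟫ ∂(sphericalGaussian m s) =
      ⟪w, m⟫ * tail ((τ - ⟪u, m⟫) / s) := by
  rw [setIntegral_sphericalGaussian_halfspace hs]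
  simp only [inner_add_right, real_inner_smul_right]
  rw [integral_add (integrable_const _).integrableOn, integral_const_mul,
    stdGaussian_halfspace_orthogonal huw, setIntegral_const, stdGaussian_halfspace hu]
  · simp [mul_comm]
  · exact ((IsGaussian.integrable_fun_id.const_inner w).const_mul s).integrableOn

lemma integral_norm_sub_sq_sphericalGaussian (m c : EuclideanSpace ℝ (Fin d)) (s : ℝ) :
    ∫ x, ‖x - c‖ ^ 2 ∂(sphericalGaussian m s) =
      ∫ x, ‖x - m‖ ^ 2 ∂(sphericalGaussian m s) + ‖m - c‖ ^ 2 := by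
  have h1 := integrable_id_sphericalGaussian m s
  have h2 : Integrable (fun x => ‖x - m‖ ^ 2) (sphericalGaussian m s) :=
    ((IsGaussian.memLp_two_id (μ := sphericalGaussian m s)).sub
      (memLp_const m)).integrable_norm_pow two_ne_zero
  have h3 : Integrable (fun x => ⟪m - c, x - m⟫) (sphericalGaussian m s) :=
    (h1.sub (integrable_const m)).const_inner _
  have h4 : ∀ x, ‖x - c‖ ^ 2 = ‖x - m‖ ^ 2 + (2 * ⟪m - c, x - m⟫ + ‖m - c‖ ^ 2) := fun x => by
    rw [← sub_add_sub_cancel x m c, norm_add_sq_real, real_inner_comm]; ring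
  have h5 : ∫ x, ⟪m - c, x - m⟫ ∂(sphericalGaussian m s) = 0 := by
    rw [integral_inner (by exact h1.sub (integrable_const m)) (m - c),
      integral_sub h1 (integrable_const m), integral_id_sphericalGaussian, integral_const, probReal_univ, one_smul, sub_self,
      inner_zero_right]
  rw [integral_congr_ae (ae_of_all _ h4), integral_add h2, integral_add, integral_const_mul, h5,
    integral_const, probReal_univ, one_smul, mul_zero, zero_add]
  · exact h3.const_mul 2
  · exact integrable_const _
  · exact (h3.const_mul 2).add (integrable_const _)

end SphericalGaussian

/-! ### The cost and the stationarity of optimal centers -/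

section Cost

variable {d : ℕ} {P : Measure (Datum d)} {θ : Fin 2 → EuclideanSpace ℝ (Fin d)}

lemma measurable_predict (θ : Fin 2 → EuclideanSpace ℝ (Fin d)) : Measurable (predict θ) :=
  Measurable.ite (measurableSet_le (by fun_prop) (by fun_prop)) measurable_const measurable_const

lemma measurableSet_predict_eq (θ : Fin 2 → EuclideanSpace ℝ (Fin d)) (j : Fin 2) :
    MeasurableSet {p : Datum d | predict θ p.2 = j} :=
  ((measurable_predict θ).comp measurable_snd) (measurableSet_singleton j)

lemma min_eq_norm_sub_predict (θ : Fin 2 → EuclideanSpace ℝ (Fin d))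
    (x : EuclideanSpace ℝ (Fin d)) :
    min (‖x - θ 0‖ ^ 2) (‖x - θ 1‖ ^ 2) = ‖x - θ (predict θ x)‖ ^ 2 := by
  unfold predict
  split_ifs with h
  · exact min_eq_left (by gcongr)
  · exact min_eq_right (by gcongr; exact (not_le.1 h).le)

lemma min_le_norm_sub (θ : Fin 2 → EuclideanSpace ℝ (Fin d)) (x : EuclideanSpace ℝ (Fin d))
    (j : Fin 2) : min (‖x - θ 0‖ ^ 2) (‖x - θ 1‖ ^ 2) ≤ ‖x - θ j‖ ^ 2 := by
  fin_cases j
  · exact min_le_left _ _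
  · exact min_le_right _ _

lemma integrable_of_abs_le [IsFiniteMeasure P] (hP : Integrable (fun p : Datum d => ‖p.2‖ ^ 2) P)
    {f : Datum d → ℝ} (hf : Measurable f) {C : ℝ} (h : ∀ p, |f p| ≤ C * (1 + ‖p.2‖ ^ 2)) :
    Integrable f P :=
  (((integrable_const 1).add hP).const_mul C).mono' hf.aestronglyMeasurable
    (ae_of_all _ h)

lemma norm_sub_sq_le (x c : EuclideanSpace ℝ (Fin d)) :
    ‖x - c‖ ^ 2 ≤ (2 + 2 * ‖c‖ ^ 2) * (1 + ‖x‖ ^ 2) := by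
  have h1 := norm_sub_le x c
  have h2 : ‖x - c‖ ^ 2 ≤ (‖x‖ + ‖c‖) ^ 2 := by gcongr
  nlinarith [sq_nonneg (‖x‖ - ‖c‖), mul_nonneg (sq_nonneg ‖x‖) (sq_nonneg ‖c‖)]

lemma integrable_norm_sub_sq [IsFiniteMeasure P]
    (hP : Integrable (fun p : Datum d => ‖p.2‖ ^ 2) P) (c : EuclideanSpace ℝ (Fin d)) :
    Integrable (fun p : Datum d => ‖p.2 - c‖ ^ 2) P :=
  integrable_of_abs_le hP (by fun_prop) fun p => by
    rw [abs_of_nonneg (by positivity)]; exact norm_sub_sq_le p.2 c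

lemma integrable_min [IsFiniteMeasure P]
    (hP : Integrable (fun p : Datum d => ‖p.2‖ ^ 2) P) (θ : Fin 2 → EuclideanSpace ℝ (Fin d)) :
    Integrable (fun p : Datum d => min (‖p.2 - θ 0‖ ^ 2) (‖p.2 - θ 1‖ ^ 2)) P :=
  integrable_of_abs_le hP (by fun_prop) fun p => by
    rw [abs_of_nonneg (by positivity)]
    exact (min_le_left _ _).trans (norm_sub_sq_le p.2 (θ 0))

lemma integrable_snd [IsFiniteMeasure P] (hP : Integrable (fun p : Datum d => ‖p.2‖ ^ 2) P) :
    Integrable (fun p : Datum d => p.2) P :=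
  ((integrable_const 1).add hP).mono' measurable_snd.aestronglyMeasurable
    (ae_of_all _ fun p => by simp only [Pi.add_apply]; nlinarith [sq_nonneg (‖p.2‖ - 1)])

/-- At optimal centers, each center is the mean of its cluster. -/
lemma setIntegral_sub_center_eq_zero [IsProbabilityMeasure P]
    (hP : Integrable (fun p : Datum d => ‖p.2‖ ^ 2) P) (hθ : ∀ η, cost P θ ≤ cost P η)
    (j : Fin 2) : ∫ p in {p | predict θ p.2 = j}, (p.2 - θ j) ∂P = 0 := by
  classical
  set C := {p : Datum d | predict θ p.2 = j} with hC
  set g := ∫ p in C, (p.2 - θ j) ∂P with hg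
  have hCm : MeasurableSet C := measurableSet_predict_eq θ j
  have hi : Integrable (fun p : Datum d => p.2 - θ j) P :=
    (integrable_snd hP).sub (integrable_const _)
  have hi2 : Integrable (fun p : Datum d => ⟪g, p.2 - θ j⟫) P := hi.const_inner g
  set k : Datum d → ℝ := fun p => ‖g‖ ^ 2 - 2 * ⟪g, p.2 - θ j⟫ with hk
  have hki : Integrable k P := (integrable_const _).sub (hi2.const_mul 2)
  -- Center `j` is moved by the residual `g` itself while the old assignment is kept. The cost
  -- changes by at most `(P.real C - 2) * ‖g‖ ^ 2`, so optimality forces `g = 0`; clusters of mass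
  -- zero need no special case.
  have hle : cost P (Function.update θ j (θ j + g)) ≤ cost P θ + ∫ p in C, k p ∂P := by
    rw [cost, cost, ← integral_indicator hCm, ← integral_add (integrable_min hP θ)
      (hki.indicator hCm)]
    refine integral_mono (integrable_min hP _) ((integrable_min hP θ).add (hki.indicator hCm))
      fun p => ?_
    refine (min_le_norm_sub _ p.2 (predict θ p.2)).trans ?_
    simp only [min_eq_norm_sub_predict θ]
    by_cases hp : predict θ p.2 = j
    · rw [indicator_of_mem (by exact hp), hp, Function.update_self, ← sub_sub, norm_sub_sq_real,
        real_inner_comm]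
      simp only [hk]; linarith
    · rw [indicator_of_notMem (by exact hp), Function.update_of_ne hp, add_zero]
  have hint : ∫ p in C, k p ∂P = (P.real C - 2) * ‖g‖ ^ 2 := by
    rw [hk, integral_sub (integrable_const _) (hi2.const_mul 2).integrableOn, integral_const_mul,
      integral_inner hi.integrableOn, ← hg, real_inner_self_eq_norm_sq]
    simp
    ring
  have h1 := hθ (Function.update θ j (θ j + g))
  have h2 : P.real C ≤ 1 := measureReal_le_one
  have h3 : ‖g‖ ^ 2 ≤ 0 := by nlinarith [sq_nonneg ‖g‖]
  simpa using h3

lemma setIntegral_inner_center [IsProbabilityMeasure P]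
    (hP : Integrable (fun p : Datum d => ‖p.2‖ ^ 2) P) (hθ : ∀ η, cost P θ ≤ cost P η)
    (j : Fin 2) (w : EuclideanSpace ℝ (Fin d)) :
    ∫ p in {p | predict θ p.2 = j}, ⟪w, p.2⟫ ∂P =
      P.real {p | predict θ p.2 = j} * ⟪w, θ j⟫ := by
  have hi : Integrable (fun p : Datum d => p.2 - θ j) P :=
    (integrable_snd hP).sub (integrable_const _)
  have h := integral_inner (𝕜 := ℝ) (μ := P.restrict {p | predict θ p.2 = j}) hi.integrableOn w
  rw [setIntegral_sub_center_eq_zero hP hθ, inner_zero_right] at h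
  have hw : Integrable (fun p : Datum d => ⟪w, p.2⟫) P := (integrable_snd hP).const_inner w
  simp only [inner_sub_right] at h
  rw [integral_sub hw.integrableOn (integrable_const _)] at h
  simp only [integral_const, measureReal_restrict_apply_univ, smul_eq_mul] at h
  linarith

/-- Decomposition of the spread around a point into the cost and the spread of the centers. -/
lemma integral_norm_sub_sq_eq_cost_add [IsProbabilityMeasure P]
    (hP : Integrable (fun p : Datum d => ‖p.2‖ ^ 2) P) (hθ : ∀ η, cost P θ ≤ cost P η)
    (c : EuclideanSpace ℝ (Fin d)) :
    ∫ p, ‖p.2 - c‖ ^ 2 ∂P = cost P θ +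
      (P.real {p | predict θ p.2 = 0} * ‖θ 0 - c‖ ^ 2 +
        P.real {p | predict θ p.2 = 1} * ‖θ 1 - c‖ ^ 2) := by
  have hj : ∀ j, ∫ p in {p | predict θ p.2 = j}, ‖p.2 - c‖ ^ 2 ∂P =
      ∫ p in {p | predict θ p.2 = j}, min (‖p.2 - θ 0‖ ^ 2) (‖p.2 - θ 1‖ ^ 2) ∂P +
        P.real {p | predict θ p.2 = j} * ‖θ j - c‖ ^ 2 := fun j => by
    have hi : Integrable (fun p : Datum d => ⟪θ j - c, p.2⟫) P :=
      (integrable_snd hP).const_inner _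
    have h1 : ∫ p in {p | predict θ p.2 = j}, ‖p.2 - c‖ ^ 2 ∂P =
        ∫ p in {p | predict θ p.2 = j}, (min (‖p.2 - θ 0‖ ^ 2) (‖p.2 - θ 1‖ ^ 2) +
          (2 * ⟪θ j - c, p.2⟫ + (‖θ j - c‖ ^ 2 - 2 * ⟪θ j - c, θ j⟫))) ∂P := by
      refine setIntegral_congr_fun (measurableSet_predict_eq θ j) fun p hp => ?_
      simp only [min_eq_norm_sub_predict]
      rw [show predict θ p.2 = j from hp, ← sub_add_sub_cancel p.2 (θ j) c, norm_add_sq_real,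
        real_inner_comm, inner_sub_right (θ j - c)]
      ring
    rw [h1, integral_add (integrable_min hP θ).integrableOn
      (by exact ((hi.const_mul 2).add (integrable_const _)).integrableOn), integral_add
      (hi.const_mul 2).integrableOn (integrable_const _), integral_const_mul,
      setIntegral_inner_center hP hθ]
    simp only [integral_const, measureReal_restrict_apply_univ, smul_eq_mul]
    ring
  have hc : {p : Datum d | predict θ p.2 = 1} = {p | predict θ p.2 = 0}ᶜ := by
    ext p; simp only [mem_ofPred_eq, mem_compl_iff]; omega
  have h0 := hj 0
  have h1 := hj 1
  rw [← integral_add_compl (measurableSet_predict_eq θ 0) (integrable_norm_sub_sq hP c), cost,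
    ← integral_add_compl (measurableSet_predict_eq θ 0) (integrable_min hP θ), h0, ← hc, h1]
  ring

end Cost

/-! ### Integrals against the mixture -/

section Mixture

variable {d : ℕ} {μ₁ μ₂ : EuclideanSpace ℝ (Fin d)} {σ₁ σ₂ : ℝ}

instance : IsProbabilityMeasure (mixture μ₁ μ₂ σ₁ σ₂) where
  measure_univ := by
    simp only [mixture, Measure.smul_apply, Measure.add_apply, measure_univ, smul_eq_mul]
    rw [one_add_one_eq_two]
    exact ENNReal.inv_mul_cancel two_ne_zero ENNReal.ofNat_ne_top

lemma integrable_mixture {f : Datum d → ℝ}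
    (h0 : Integrable (fun x => f (0, x)) (sphericalGaussian μ₁ σ₁))
    (h1 : Integrable (fun x => f (1, x)) (sphericalGaussian μ₂ σ₂)) :
    Integrable f (mixture μ₁ μ₂ σ₁ σ₂) := by
  unfold mixture
  rw [Measure.dirac_prod, Measure.dirac_prod]
  refine Integrable.smul_measure (Integrable.add_measure ?_ ?_) (by simp)
  · exact (measurableEmbedding_prodMk_left _).integrable_map_iff.2 h0
  · exact (measurableEmbedding_prodMk_left _).integrable_map_iff.2 h1

lemma integral_mixture {f : Datum d → ℝ}
    (h0 : Integrable (fun x => f (0, x)) (sphericalGaussian μ₁ σ₁))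
    (h1 : Integrable (fun x => f (1, x)) (sphericalGaussian μ₂ σ₂)) :
    ∫ p, f p ∂(mixture μ₁ μ₂ σ₁ σ₂) = 1 / 2 * (∫ x, f (0, x) ∂(sphericalGaussian μ₁ σ₁) +
      ∫ x, f (1, x) ∂(sphericalGaussian μ₂ σ₂)) := by
  unfold mixture
  rw [Measure.dirac_prod, Measure.dirac_prod, integral_smul_measure, integral_add_measure,
    (measurableEmbedding_prodMk_left _).integral_map,
    (measurableEmbedding_prodMk_left _).integral_map]
  · simp
  · exact (measurableEmbedding_prodMk_left _).integrable_map_iff.2 h0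
  · exact (measurableEmbedding_prodMk_left _).integrable_map_iff.2 h1

lemma mixture_real {s : Set (Datum d)} (hs : MeasurableSet s) :
    (mixture μ₁ μ₂ σ₁ σ₂).real s = 1 / 2 * ((sphericalGaussian μ₁ σ₁).real {x | (0, x) ∈ s} +
      (sphericalGaussian μ₂ σ₂).real {x | (1, x) ∈ s}) := by
  have hm : ∀ i : Fin 2, MeasurableSet {x : EuclideanSpace ℝ (Fin d) | (i, x) ∈ s} :=
    fun i => measurable_prodMk_left hs
  have h := integral_mixture (μ₁ := μ₁) (μ₂ := μ₂) (σ₁ := σ₁) (σ₂ := σ₂)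
    (f := s.indicator 1) ((integrable_const (1 : ℝ)).indicator (hm 0))
    ((integrable_const (1 : ℝ)).indicator (hm 1))
  have e : ∀ i : Fin 2, (fun x => s.indicator (1 : Datum d → ℝ) (i, x)) =
      {x : EuclideanSpace ℝ (Fin d) | (i, x) ∈ s}.indicator 1 := fun i => rfl
  rw [integral_indicator_one hs] at h
  simp only [e] at h
  rw [integral_indicator_one (hm 0), integral_indicator_one (hm 1)] at h
  exact h

lemma integrable_norm_sq_mixture :
    Integrable (fun p : Datum d => ‖p.2‖ ^ 2) (mixture μ₁ μ₂ σ₁ σ₂) :=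
  integrable_mixture (integrable_norm_sq_sphericalGaussian _ _)
    (integrable_norm_sq_sphericalGaussian _ _)

/-- The class means beat every single center by a quarter of their squared distance. -/
lemma cost_class_means_add_le (c : EuclideanSpace ℝ (Fin d)) :
    cost (mixture μ₁ μ₂ σ₁ σ₂) ![μ₁, μ₂] + ‖μ₁ - μ₂‖ ^ 2 / 4 ≤
      ∫ p, ‖p.2 - c‖ ^ 2 ∂(mixture μ₁ μ₂ σ₁ σ₂) := by
  have hi : ∀ (m c : EuclideanSpace ℝ (Fin d)) (s : ℝ),
      Integrable (fun x => ‖x - c‖ ^ 2) (sphericalGaussian m s) := fun m c s =>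
    ((IsGaussian.memLp_two_id (μ := sphericalGaussian m s)).sub
      (memLp_const c)).integrable_norm_pow two_ne_zero
  have h1 : cost (mixture μ₁ μ₂ σ₁ σ₂) ![μ₁, μ₂] ≤
      ∫ p, ‖p.2 - (![μ₁, μ₂] p.1)‖ ^ 2 ∂(mixture μ₁ μ₂ σ₁ σ₂) :=
    integral_mono (integrable_min integrable_norm_sq_mixture _)
      (integrable_mixture (hi _ _ _) (hi _ _ _)) fun p => min_le_norm_sub _ p.2 p.1
  rw [integral_mixture (hi _ _ _) (hi _ _ _)] at h1
  rw [integral_mixture (hi _ _ _) (hi _ _ _), integral_norm_sub_sq_sphericalGaussian μ₁ c,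
    integral_norm_sub_sq_sphericalGaussian μ₂ c]
  have h2 : ‖μ₁ - μ₂‖ ^ 2 ≤ 2 * (‖μ₁ - c‖ ^ 2 + ‖μ₂ - c‖ ^ 2) := by
    have := parallelogram_law_with_norm ℝ (μ₁ - c) (μ₂ - c)
    rw [sub_sub_sub_cancel_right] at this
    nlinarith [sq_nonneg ‖μ₁ - c + (μ₂ - c)‖]
  simp at h1
  linarith

end Mixture

/-! ### From optimal centers of the mixture to a balanced threshold -/

section Population

variable {d : ℕ} {μ₁ μ₂ : EuclideanSpace ℝ (Fin d)} {σ₁ σ₂ : ℝ}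
  {θ : Fin 2 → EuclideanSpace ℝ (Fin d)}

/-- The inequality is strict because ties go to cluster `0`. -/
lemma predict_eq_one_iff {u : EuclideanSpace ℝ (Fin d)} {l : ℝ} (hu : ‖u‖ = 1) (hl : 0 < l)
    (hθ : θ 1 = θ 0 + l • u) (x : EuclideanSpace ℝ (Fin d)) :
    predict θ x = 1 ↔ ⟪u, θ 0⟫ + l / 2 < ⟪u, x⟫ := by
  have h1 : ‖x - θ 1‖ ^ 2 = ‖x - θ 0‖ ^ 2 - 2 * l * (⟪u, x⟫ - ⟪u, θ 0⟫) + l ^ 2 := by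
    rw [hθ, ← sub_sub, norm_sub_sq_real, real_inner_smul_right, norm_smul, hu, real_inner_comm,
      inner_sub_right, mul_one, Real.norm_eq_abs, sq_abs]
    ring
  have h2 : predict θ x = 1 ↔ ‖x - θ 1‖ ^ 2 < ‖x - θ 0‖ ^ 2 := by
    rw [sq_lt_sq₀ (norm_nonneg _) (norm_nonneg _)]
    unfold predict
    split_ifs with h
    · simpa using h
    · simpa using h
  rw [h2, h1]
  constructor <;> intro h <;> nlinarith

lemma predict_ne_zero_iff (θ : Fin 2 → EuclideanSpace ℝ (Fin d)) (x : EuclideanSpace ℝ (Fin d)) :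
    predict θ x ≠ 0 ↔ predict θ x = 1 := by omega

lemma setIntegral_mixture {f : EuclideanSpace ℝ (Fin d) → ℝ} {s : Set (EuclideanSpace ℝ (Fin d))}
    (hs : MeasurableSet s) (h0 : Integrable f (sphericalGaussian μ₁ σ₁))
    (h1 : Integrable f (sphericalGaussian μ₂ σ₂)) :
    ∫ p in {p : Datum d | p.2 ∈ s}, f p.2 ∂(mixture μ₁ μ₂ σ₁ σ₂) =
      1 / 2 * (∫ x in s, f x ∂(sphericalGaussian μ₁ σ₁) +
        ∫ x in s, f x ∂(sphericalGaussian μ₂ σ₂)) := by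
  have hs' : MeasurableSet {p : Datum d | p.2 ∈ s} := measurable_snd hs
  rw [← integral_indicator hs', ← integral_indicator hs, ← integral_indicator hs]
  exact integral_mixture (f := indicator {p : Datum d | p.2 ∈ s} fun p => f p.2)
    (h0.indicator hs) (h1.indicator hs)

lemma integrable_inner_sphericalGaussian (m w : EuclideanSpace ℝ (Fin d)) (s : ℝ) :
    Integrable (fun x => ⟪w, x⟫) (sphericalGaussian m s) :=
  (integrable_id_sphericalGaussian m s).const_inner w

lemma integral_inner_sphericalGaussian (m w : EuclideanSpace ℝ (Fin d)) (s : ℝ) :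
    ∫ x, ⟪w, x⟫ ∂(sphericalGaussian m s) = ⟪w, m⟫ := by
  rw [integral_inner (integrable_id_sphericalGaussian m s), integral_id_sphericalGaussian]

lemma measurableSet_label (j : Fin 2) : MeasurableSet {p : Datum d | p.1 = j} :=
  measurable_fst (measurableSet_singleton j)

lemma measurableSet_label_and_predict (θ : Fin 2 → EuclideanSpace ℝ (Fin d)) (i j : Fin 2) :
    MeasurableSet {p : Datum d | p.1 = i ∧ predict θ p.2 = j} :=
  (measurableSet_label i).inter (measurableSet_predict_eq θ j)

lemma mixture_real_label (j : Fin 2) :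
    (mixture μ₁ μ₂ σ₁ σ₂).real {p | p.1 = j} = 1 / 2 := by
  rw [mixture_real (measurableSet_label j)]
  fin_cases j <;> simp

lemma acc_eq_div (P : Measure (Datum d)) (θ : Fin 2 → EuclideanSpace ℝ (Fin d)) (j : Fin 2) :
    acc P θ j = P.real {p | p.1 = j ∧ predict θ p.2 = j} / P.real {p | p.1 = j} := by
  rw [acc, Measure.real, cond_apply (measurableSet_label j),
    ENNReal.toReal_mul, ENNReal.toReal_inv, div_eq_inv_mul]
  rfl

lemma acc_mixture (j : Fin 2) : acc (mixture μ₁ μ₂ σ₁ σ₂) θ j =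
    (sphericalGaussian (![μ₁, μ₂] j) (![σ₁, σ₂] j)).real {x | predict θ x = j} := by
  rw [acc_eq_div, mixture_real_label, mixture_real (measurableSet_label_and_predict θ j j)]
  fin_cases j <;> simp <;> ring

lemma setIntegral_inner_halfspace_compl (m w u : EuclideanSpace ℝ (Fin d)) (s τ : ℝ) :
    ∫ x in {x | τ < ⟪u, x⟫}ᶜ, ⟪w, x⟫ ∂(sphericalGaussian m s) =
      ⟪w, m⟫ - ∫ x in {x | τ < ⟪u, x⟫}, ⟪w, x⟫ ∂(sphericalGaussian m s) := by
  rw [← integral_inner_sphericalGaussian m w s, ← integral_add_compl (measurableSet_halfspace u τ)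
    (integrable_inner_sphericalGaussian m w s)]
  ring

lemma optimal_centers_ne (hsep : 0 < ‖μ₁ - μ₂‖)
    (hopt : ∀ η, cost (mixture μ₁ μ₂ σ₁ σ₂) θ ≤ cost (mixture μ₁ μ₂ σ₁ σ₂) η) : θ 0 ≠ θ 1 := by
  intro h
  have h1 := hopt ![μ₁, μ₂]
  have h2 := cost_class_means_add_le (μ₁ := μ₁) (μ₂ := μ₂) (σ₁ := σ₁) (σ₂ := σ₂) (θ 1)
  have h3 : cost (mixture μ₁ μ₂ σ₁ σ₂) θ = ∫ p, ‖p.2 - θ 1‖ ^ 2 ∂(mixture μ₁ μ₂ σ₁ σ₂) := by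
    simp [cost, h]
  nlinarith

/-- First-order conditions for optimal centers of the Gaussian mixture, in terms of the unit
vector `u` from the first center to the second one and of the standardized distances `z₁`, `z₂` of
the class means to the separating hyperplane. -/
lemma first_order_conditions (h1 : 0 < σ₁) (h2 : 0 < σ₂)
    (hopt : ∀ η, cost (mixture μ₁ μ₂ σ₁ σ₂) θ ≤ cost (mixture μ₁ μ₂ σ₁ σ₂) η)
    {u : EuclideanSpace ℝ (Fin d)} {l τ z₁ z₂ : ℝ} (hu : ‖u‖ = 1) (hl : 0 < l)
    (hθ : θ 1 = θ 0 + l • u) (hτ : τ = ⟪u, θ 0⟫ + l / 2) (hz1 : z₁ = (τ - ⟪u, μ₁⟫) / σ₁)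
    (hz2 : z₂ = (τ - ⟪u, μ₂⟫) / σ₂) :
    (mixture μ₁ μ₂ σ₁ σ₂).real {p | predict θ p.2 = 1} = (tail z₁ + tail z₂) / 2 ∧
    (mixture μ₁ μ₂ σ₁ σ₂).real {p | predict θ p.2 = 0} = (tail (-z₁) + tail (-z₂)) / 2 ∧
    l * (tail z₁ + tail z₂) / 2 = σ₁ * excess z₁ + σ₂ * excess z₂ ∧
    l * (tail (-z₁) + tail (-z₂)) / 2 = σ₁ * excess (-z₁) + σ₂ * excess (-z₂) ∧
    ∀ w, ⟪u, w⟫ = 0 → ⟪w, μ₁ - μ₂⟫ * (tail z₁ - tail z₂) = 0 := by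
  set P := mixture μ₁ μ₂ σ₁ σ₂ with hP
  have hPi : Integrable (fun p : Datum d => ‖p.2‖ ^ 2) P := integrable_norm_sq_mixture
  set H := {x : EuclideanSpace ℝ (Fin d) | τ < ⟪u, x⟫} with hH
  have hHm : MeasurableSet H := measurableSet_halfspace u τ
  have hpred1 : {p : Datum d | predict θ p.2 = 1} = {p | p.2 ∈ H} := by
    ext p; rw [mem_ofPred_eq, predict_eq_one_iff hu hl hθ, ← hτ]; rfl
  have hpred0 : {p : Datum d | predict θ p.2 = 0} = {p | p.2 ∈ Hᶜ} := by
    ext p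
    rw [mem_ofPred_eq, ← not_iff_not, ← ne_eq, predict_ne_zero_iff, predict_eq_one_iff hu hl hθ,
      ← hτ]
    simp [hH]
  have hm1 := sphericalGaussian_halfspace (m := μ₁) hu h1 τ
  have hm2 := sphericalGaussian_halfspace (m := μ₂) hu h2 τ
  rw [← hz1] at hm1
  rw [← hz2] at hm2
  have p1 : P.real {p | predict θ p.2 = 1} = (tail z₁ + tail z₂) / 2 := by
    rw [mixture_real (measurableSet_predict_eq θ 1)]
    have e : ∀ i : Fin 2, {x | ((i, x) : Datum d) ∈ {p : Datum d | predict θ p.2 = 1}} = H :=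
      fun i => by rw [hpred1]; rfl
    rw [e, e, hm1, hm2]; ring
  have p0 : P.real {p | predict θ p.2 = 0} = (tail (-z₁) + tail (-z₂)) / 2 := by
    have e : {p : Datum d | predict θ p.2 = 0} = {p | predict θ p.2 = 1}ᶜ := by
      rw [hpred0, hpred1]; rfl
    rw [e, probReal_compl_eq_one_sub (measurableSet_predict_eq θ 1), p1, tail_neg, tail_neg]
    ring
  have c1 : ∀ w, P.real {p | predict θ p.2 = 1} * ⟪w, θ 1⟫ =
      1 / 2 * (∫ x in H, ⟪w, x⟫ ∂(sphericalGaussian μ₁ σ₁) +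
        ∫ x in H, ⟪w, x⟫ ∂(sphericalGaussian μ₂ σ₂)) := fun w => by
    rw [← setIntegral_inner_center hPi hopt, hpred1, setIntegral_mixture hHm
      (integrable_inner_sphericalGaussian _ _ _) (integrable_inner_sphericalGaussian _ _ _)]
  have c0 : ∀ w, P.real {p | predict θ p.2 = 0} * ⟪w, θ 0⟫ =
      1 / 2 * ((⟪w, μ₁⟫ - ∫ x in H, ⟪w, x⟫ ∂(sphericalGaussian μ₁ σ₁)) +
        (⟪w, μ₂⟫ - ∫ x in H, ⟪w, x⟫ ∂(sphericalGaussian μ₂ σ₂))) := fun w => by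
    rw [← setIntegral_inner_center hPi hopt, hpred0, setIntegral_mixture hHm.compl
      (integrable_inner_sphericalGaussian _ _ _) (integrable_inner_sphericalGaussian _ _ _),
      setIntegral_inner_halfspace_compl, setIntegral_inner_halfspace_compl]
  have hex : ∀ {m : EuclideanSpace ℝ (Fin d)} {s z : ℝ}, 0 < s → z = (τ - ⟪u, m⟫) / s →
      ∫ x in H, ⟪u, x⟫ ∂(sphericalGaussian m s) = s * excess z + τ * tail z := by
    intro m s z hs hz
    have := sphericalGaussian_halfspace_excess (m := m) hu hs τ
    rw [integral_sub (integrable_inner_sphericalGaussian _ _ _).integrableOn (integrable_const _),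
      setIntegral_const, sphericalGaussian_halfspace hu hs, ← hz, smul_eq_mul] at this
    rw [hH]; linarith
  have hu1 : ⟪u, θ 1⟫ = τ + l / 2 := by
    rw [hθ, inner_add_right, real_inner_smul_right, real_inner_self_eq_norm_sq, hu, hτ]; ring
  have hu0 : ⟪u, θ 0⟫ = τ - l / 2 := by rw [hτ]; ring
  refine ⟨p1, p0, ?_, ?_, fun w hw => ?_⟩
  · have := c1 u
    rw [p1, hu1, hex h1 hz1, hex h2 hz2] at this
    linarith
  · have := c0 u
    rw [p0, hu0, hex h1 hz1, hex h2 hz2, tail_neg, tail_neg] at this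
    rw [tail_neg, tail_neg, excess_neg, excess_neg]
    have e1 : σ₁ * z₁ = τ - ⟪u, μ₁⟫ := by rw [hz1]; field_simp
    have e2 : σ₂ * z₂ = τ - ⟪u, μ₂⟫ := by rw [hz2]; field_simp
    linarith
  · have k1 := c1 w
    have k0 := c0 w
    have hw1 : ⟪w, θ 1⟫ = ⟪w, θ 0⟫ := by
      rw [hθ, inner_add_right, real_inner_smul_right, real_inner_comm u w, hw]; ring
    rw [p1, hw1, sphericalGaussian_halfspace_orthogonal hu h1 τ hw,
      sphericalGaussian_halfspace_orthogonal hu h2 τ hw, ← hz1, ← hz2] at k1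
    rw [p0, sphericalGaussian_halfspace_orthogonal hu h1 τ hw,
      sphericalGaussian_halfspace_orthogonal hu h2 τ hw, ← hz1, ← hz2, tail_neg, tail_neg] at k0
    rw [inner_sub_right]
    -- Sum of the two mean conditions: both centers have the same `w`-component, so it is that of
    -- the overall mean.
    have k2 : ⟪w, θ 0⟫ = (⟪w, μ₁⟫ + ⟪w, μ₂⟫) / 2 := by linarith
    rw [k2] at k1
    linarith

/-- Optimal centers of a well-separated mixture do not cut off equal shares of both classes. -/
lemma tail_ne_of_optimal (h1 : 0 < σ₁) (h2 : 0 < σ₂) (hsep : σ₁ + σ₂ < ‖μ₁ - μ₂‖)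
    (hopt : ∀ η, cost (mixture μ₁ μ₂ σ₁ σ₂) θ ≤ cost (mixture μ₁ μ₂ σ₁ σ₂) η)
    {u : EuclideanSpace ℝ (Fin d)} {l τ z₁ z₂ : ℝ} (hu : ‖u‖ = 1) (hl : 0 < l)
    (hθ : θ 1 = θ 0 + l • u) (hτ : τ = ⟪u, θ 0⟫ + l / 2) (hz1 : z₁ = (τ - ⟪u, μ₁⟫) / σ₁)
    (hz2 : z₂ = (τ - ⟪u, μ₂⟫) / σ₂) : tail z₁ ≠ tail z₂ := by
  intro heq
  obtain ⟨p1, p0, e1, e0, -⟩ := first_order_conditions h1 h2 hopt hu hl hθ hτ hz1 hz2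
  have hz : z₁ = z₂ := tail_strictAnti.injective heq
  rw [← hz] at p1 p0 e1 e0
  set q := tail z₁
  rw [tail_neg] at p0
  have hq0 : 0 < q := tail_pos z₁
  have hq1 : q < 1 := tail_lt_one z₁
  have hφ := stdPdf_sq_le z₁
  rw [tail_neg] at e0 hφ
  rw [excess_neg] at e0
  have hex : excess z₁ = stdPdf z₁ - z₁ * q := rfl
  have hl1 : 2 * (l * (q * (1 - q))) = (σ₁ + σ₂) * stdPdf z₁ := by
    rw [hex] at e1 e0
    linear_combination (1 - q) * e1 + q * e0
  -- Around the mean of the centers their spread is `q * (1 - q) * l ^ 2`. Being no worse than the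
  -- class means requires at least `‖μ₁ - μ₂‖ ^ 2 / 4`; `hl1` and `stdPdf_sq_le` allow at most `(σ₁
  -- + σ₂) ^ 2 / 4`.
  have hV := integral_norm_sub_sq_eq_cost_add (P := mixture μ₁ μ₂ σ₁ σ₂) integrable_norm_sq_mixture
    hopt (θ 0 + (q * l) • u)
  have n0 : ‖θ 0 - (θ 0 + (q * l) • u)‖ ^ 2 = (q * l) ^ 2 := by
    rw [sub_add_cancel_left, norm_neg, norm_smul, hu, mul_one, Real.norm_eq_abs, sq_abs]
  have n1 : ‖θ 1 - (θ 0 + (q * l) • u)‖ ^ 2 = ((1 - q) * l) ^ 2 := by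
    rw [hθ, add_sub_add_left_eq_sub, ← sub_smul, norm_smul, hu, mul_one, Real.norm_eq_abs, sq_abs]
    ring
  rw [p1, p0, n0, n1] at hV
  have hgain := cost_class_means_add_le (μ₁ := μ₁) (μ₂ := μ₂) (σ₁ := σ₁) (σ₂ := σ₂)
    (θ 0 + (q * l) • u)
  have hle := hopt ![μ₁, μ₂]
  have hp : 0 < q * (1 - q) := mul_pos hq0 (by linarith)
  have hD : ‖μ₁ - μ₂‖ ^ 2 ≤ 4 * (q * (1 - q) * l ^ 2) := by linarith
  have hsq : (2 * (l * (q * (1 - q)))) ^ 2 ≤ (σ₁ + σ₂) ^ 2 * (q * (1 - q)) := by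
    rw [hl1, mul_pow]; gcongr
  have hD2 : ‖μ₁ - μ₂‖ ^ 2 * (q * (1 - q)) ≤ (σ₁ + σ₂) ^ 2 * (q * (1 - q)) := by
    nlinarith
  have hD3 := le_of_mul_le_mul_right hD2 hp
  nlinarith

/-- Optimal aligned centers of the mixture cut it by a hyperplane orthogonal to `μ₂ - μ₁`, at a
balanced threshold. -/
theorem exists_balanced_threshold (h1 : 0 < σ₁) (h12 : σ₁ ≤ σ₂) (hsep : 2 * σ₂ < ‖μ₁ - μ₂‖)
    (hopt : ∀ η, cost (mixture μ₁ μ₂ σ₁ σ₂) θ ≤ cost (mixture μ₁ μ₂ σ₁ σ₂) η)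
    (hal : IsAligned (mixture μ₁ μ₂ σ₁ σ₂) θ) :
    ∃ t, 0 < t ∧ t < ‖μ₁ - μ₂‖ / σ₂ ∧ balance (σ₁ / σ₂) (‖μ₁ - μ₂‖ / σ₂) t = 0 ∧
      acc (mixture μ₁ μ₂ σ₁ σ₂) θ 0 = 1 - tail (t / (σ₁ / σ₂)) ∧
      acc (mixture μ₁ μ₂ σ₁ σ₂) θ 1 = 1 - tail (‖μ₁ - μ₂‖ / σ₂ - t) := by
  have h2 : 0 < σ₂ := h1.trans_le h12
  have hne := optimal_centers_ne (by linarith) hopt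
  set l := ‖θ 1 - θ 0‖ with hldef
  have hl : 0 < l := norm_pos_iff.2 (sub_ne_zero.2 hne.symm)
  set u := l⁻¹ • (θ 1 - θ 0) with hudef
  have hu : ‖u‖ = 1 := by
    rw [hudef, norm_smul, norm_inv, Real.norm_eq_abs, abs_of_pos hl]; exact inv_mul_cancel₀ hl.ne'
  have hθ : θ 1 = θ 0 + l • u := by rw [hudef, smul_inv_smul₀ hl.ne']; abel
  obtain ⟨τ, hτ⟩ : ∃ τ, τ = ⟪u, θ 0⟫ + l / 2 := ⟨_, rfl⟩
  obtain ⟨z₁, hz1⟩ : ∃ z, z = (τ - ⟪u, μ₁⟫) / σ₁ := ⟨_, rfl⟩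
  obtain ⟨z₂, hz2⟩ : ∃ z, z = (τ - ⟪u, μ₂⟫) / σ₂ := ⟨_, rfl⟩
  obtain ⟨-, -, e1, e0, eo⟩ := first_order_conditions h1 h2 hopt hu hl hθ hτ hz1 hz2
  have hQ := tail_ne_of_optimal h1 h2 (by linarith) hopt hu hl hθ hτ hz1 hz2
  have hm1 := sphericalGaussian_halfspace (m := μ₁) hu h1 τ
  have hm2 := sphericalGaussian_halfspace (m := μ₂) hu h2 τ
  rw [← hz1] at hm1
  rw [← hz2] at hm2
  have hset1 : {x | predict θ x = 1} = {x | τ < ⟪u, x⟫} := by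
    ext x; rw [mem_ofPred_eq, predict_eq_one_iff hu hl hθ, ← hτ]; rfl
  have hset0 : {x | predict θ x = 0} = {x | τ < ⟪u, x⟫}ᶜ := by
    rw [← hset1]; ext x; simp only [mem_ofPred_eq, mem_compl_iff]; omega
  have hacc1 : acc (mixture μ₁ μ₂ σ₁ σ₂) θ 1 = tail z₂ := by
    rw [acc_mixture, hset1]; exact hm2
  have hacc0 : acc (mixture μ₁ μ₂ σ₁ σ₂) θ 0 = 1 - tail z₁ := by
    rw [acc_mixture, hset0, probReal_compl_eq_one_sub (measurableSet_halfspace u τ)]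
    exact congrArg (1 - ·) hm1
  have hal' : tail z₁ ≤ tail z₂ := by
    have hc := (measurableSet_halfspace u τ)
    have hr := (ENNReal.toReal_le_toReal (measure_ne_top _ _) (measure_ne_top _ _)).2 hal
    have m1 : MeasurableSet {p : Datum d | predict θ p.2 = p.1} :=
      measurableSet_eq_fun ((measurable_predict θ).comp measurable_snd) measurable_fst
    have m0 : MeasurableSet {p : Datum d | predict θ p.2 ≠ p.1} := m1.compl
    rw [← Measure.real, ← Measure.real, mixture_real m0, mixture_real m1] at hr
    have s0 : {x | ((0, x) : Datum d) ∈ {p : Datum d | predict θ p.2 ≠ p.1}} =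
        {x | τ < ⟪u, x⟫} := by
      rw [← hset1]; ext x; simp only [mem_ofPred_eq]; omega
    have s1 : {x | ((1, x) : Datum d) ∈ {p : Datum d | predict θ p.2 ≠ p.1}} =
        {x | τ < ⟪u, x⟫}ᶜ := by
      rw [← hset1]; ext x; simp
    have s2 : {x | ((0, x) : Datum d) ∈ {p : Datum d | predict θ p.2 = p.1}} =
        {x | τ < ⟪u, x⟫}ᶜ := by rw [← hset0]; rfl
    have s3 : {x | ((1, x) : Datum d) ∈ {p : Datum d | predict θ p.2 = p.1}} =
        {x | τ < ⟪u, x⟫} := by rw [← hset1]; rfl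
    rw [s0, s1, s2, s3, probReal_compl_eq_one_sub hc, probReal_compl_eq_one_sub hc, hm1, hm2] at hr
    linarith
  set κ := ⟪u, μ₂ - μ₁⟫ with hκ
  -- The orthogonal condition is applied to the component of `μ₂ - μ₁` orthogonal to `u`, which must
  -- therefore vanish.
  have hκeq : κ = ‖μ₁ - μ₂‖ ∨ κ = -‖μ₁ - μ₂‖ := by
    have hw : ⟪u, μ₂ - μ₁ - κ • u⟫ = 0 := by
      rw [inner_sub_right, real_inner_smul_right, real_inner_self_eq_norm_sq, hu, ← hκ]; ring
    have h3 := (mul_eq_zero.1 (eo _ hw)).resolve_right (sub_ne_zero.2 hQ)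
    have h4 : ‖μ₂ - μ₁ - κ • u‖ ^ 2 = 0 := by
      rw [← real_inner_self_eq_norm_sq, inner_sub_right, real_inner_smul_right, real_inner_comm u,
        hw, mul_zero, sub_zero, ← neg_sub μ₁ μ₂, inner_neg_right, neg_sub, h3, neg_zero]
    have h5 : μ₂ - μ₁ = κ • u := sub_eq_zero.1 (norm_eq_zero.1 (pow_eq_zero_iff two_ne_zero |>.1 h4))
    have h6 : ‖μ₁ - μ₂‖ = |κ| := by
      rw [norm_sub_rev, h5, norm_smul, hu, mul_one, Real.norm_eq_abs]
    rw [h6]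
    rcases abs_choice κ with h | h <;> rw [h] <;> simp
  have hκ' : κ = ⟪u, μ₂⟫ - ⟪u, μ₁⟫ := by rw [hκ, inner_sub_right]
  have f1 : σ₁ * z₁ = τ - ⟪u, μ₁⟫ := by rw [hz1]; field_simp
  have f2 : σ₂ * z₂ = τ - ⟪u, μ₂⟫ := by rw [hz2]; field_simp
  set r := σ₁ / σ₂ with hr
  have hr0 : 0 < r := div_pos h1 h2
  have hr1 : r ≤ 1 := (div_le_one h2).2 h12
  have hrσ : σ₁ = r * σ₂ := by rw [hr]; field_simp
  -- Elimination of `l`: both cluster means are at distance `l / 2` from the cut.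
  have hprod : (r * excess z₁ + excess z₂) * (tail (-z₁) + tail (-z₂)) =
      (r * excess (-z₁) + excess (-z₂)) * (tail z₁ + tail z₂) := by
    rw [hrσ] at e1 e0
    have h7 : l * σ₂ ≠ 0 := (mul_pos hl h2).ne'
    apply mul_left_cancel₀ h7
    linear_combination l * (tail z₁ + tail z₂) * e0 - l * (tail (-z₁) + tail (-z₂)) * e1
  have hD2 : 2 < ‖μ₁ - μ₂‖ / σ₂ := by rwa [lt_div_iff₀ h2]
  rcases hκeq with hk | hk
  · have hD : ‖μ₁ - μ₂‖ / σ₂ = r * z₁ + -z₂ := by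
      rw [div_eq_iff h2.ne']
      linear_combination -hk + hκ' + f2 - f1 + z₁ * hrσ
    have h8 := balanced_of_midpoint (A := z₁) (b := -z₂) hr0 hr1 (hD ▸ hD2)
      (by rw [neg_neg]; exact hprod)
    rw [hD]
    refine ⟨r * z₁, mul_pos hr0 h8.1, by linarith [h8.2.1], h8.2.2, ?_, ?_⟩
    · rw [hacc0, mul_div_cancel_left₀ _ hr0.ne']
    · rw [hacc1, add_sub_cancel_left, tail_neg]; ring
  -- With the centers in reverse order, the classes would be matched the wrong way round, against
  -- alignment.
  · exfalso
    have hD : ‖μ₁ - μ₂‖ / σ₂ = r * -z₁ + z₂ := by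
      rw [div_eq_iff h2.ne']
      linear_combination hk - hκ' - f2 + f1 - z₁ * hrσ
    have h8 := balanced_of_midpoint (A := -z₁) (b := z₂) hr0 hr1 (hD ▸ hD2)
      (by rw [neg_neg]; exact hprod.symm)
    have h9 := tail_strictAnti (show z₁ < z₂ by linarith [h8.1, h8.2.1])
    linarith

end Population

/-! ### High-probability events -/

section HoldsWithProb

variable {Ω Ω' : Type*} [MeasurableSpace Ω] [MeasurableSpace Ω'] {Q : Measure Ω}

lemma HoldsWithProb.mono {r r' : ℝ} {A B : Ω → Prop} (h : HoldsWithProb Q r A) (hr : r' ≤ r)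
    (hAB : ∀ ω, A ω → B ω) : HoldsWithProb Q r' B := by
  obtain ⟨G, hG, hr', hA⟩ := h
  exact ⟨G, hG, (ENNReal.ofReal_le_ofReal hr).trans hr', fun ω hω => hAB ω (hA ω hω)⟩

lemma HoldsWithProb.and [IsProbabilityMeasure Q] {a b : ℝ} {A B : Ω → Prop}
    (hA : HoldsWithProb Q (1 - a) A) (hB : HoldsWithProb Q (1 - b) B) :
    HoldsWithProb Q (1 - (a + b)) fun ω => A ω ∧ B ω := by
  obtain ⟨G, hG, hGr, hGA⟩ := hA
  obtain ⟨H, hH, hHr, hHB⟩ := hB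
  refine ⟨G ∩ H, hG.inter hH, ?_, fun ω hω => ⟨hGA ω hω.1, hHB ω hω.2⟩⟩
  rw [ENNReal.ofReal_le_iff_le_toReal (measure_ne_top _ _)] at hGr hHr ⊢
  change 1 - a ≤ Q.real G at hGr
  change 1 - b ≤ Q.real H at hHr
  change 1 - (a + b) ≤ Q.real (G ∩ H)
  have h1 := measureReal_union_add_inter (μ := Q) (s := G) hH
  have h2 : Q.real (G ∪ H) ≤ 1 := measureReal_le_one
  linarith

lemma HoldsWithProb.of_map {f : Ω → Ω'} (hf : Measurable f) {r : ℝ} {A : Ω' → Prop}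
    (h : HoldsWithProb (Q.map f) r A) : HoldsWithProb Q r fun ω => A (f ω) := by
  obtain ⟨G, hG, hr, hA⟩ := h
  rw [Measure.map_apply hf hG] at hr
  exact ⟨f ⁻¹' G, hf hG, hr, fun ω hω => hA _ hω⟩

end HoldsWithProb

/-! ### The sample filter and the weak law of large numbers -/

section LawOfLargeNumbers

variable {d : ℕ} (P : Measure (Datum d)) [IsProbabilityMeasure P]

/-- The filter of the sets of measures that contain the empirical measures of large samples from
`P` with probability tending to one. -/
def sampleFilter : Filter (Measure (Datum d)) where
  sets := {A | ∀ δ : ℝ, 0 < δ → ∃ Nbar : ℕ, ∀ N : ℕ, Nbar ≤ N →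
    HoldsWithProb (Measure.pi fun _ : Fin N => P) (1 - δ) fun S => empirical S ∈ A}
  univ_sets δ hδ := ⟨0, fun N _ => ⟨univ, MeasurableSet.univ, by
    rw [measure_univ, ENNReal.ofReal_le_one]; linarith, fun _ _ => mem_univ _⟩⟩
  sets_of_superset hA hAB δ hδ := by
    obtain ⟨N₀, h⟩ := hA δ hδ
    exact ⟨N₀, fun N hN => (h N hN).mono le_rfl fun S hS => hAB hS⟩
  inter_sets {A B} hA hB δ hδ := by
    obtain ⟨N₁, h₁⟩ := hA (δ / 2) (by positivity)
    obtain ⟨N₂, h₂⟩ := hB (δ / 2) (by positivity)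
    refine ⟨max N₁ N₂, fun N hN => ?_⟩
    have h := (h₁ N ((le_max_left _ _).trans hN)).and (h₂ N ((le_max_right _ _).trans hN))
    rw [add_halves] at h
    exact h

lemma isProbabilityMeasure_empirical {N : ℕ} (hN : N ≠ 0) (S : Fin N → Datum d) :
    IsProbabilityMeasure (empirical S) where
  measure_univ := by
    simp only [empirical, Measure.smul_apply, Measure.coe_finsetSum, Finset.sum_apply,
      measure_univ, Finset.sum_const, Finset.card_univ, Fintype.card_fin, nsmul_eq_mul, mul_one,
      smul_eq_mul]
    exact ENNReal.inv_mul_cancel (by simpa using hN) (ENNReal.natCast_ne_top N)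

lemma integrable_empirical {N : ℕ} (hN : N ≠ 0) (S : Fin N → Datum d) (f : Datum d → ℝ) :
    Integrable f (empirical S) := by
  refine Integrable.smul_measure ?_ (by simpa using hN)
  exact integrable_finsetSum_measure.2 fun i _ => integrable_dirac (by simp)

lemma integral_empirical {N : ℕ} (S : Fin N → Datum d) (f : Datum d → ℝ) :
    ∫ p, f p ∂(empirical S) = (N : ℝ)⁻¹ * ∑ i, f (S i) := by
  rw [empirical, integral_smul_measure, integral_finsetSum_measure
    fun i _ => integrable_dirac (by simp)]
  simp

lemma eventually_sampleFilter_of_forall {p : Measure (Datum d) → Prop}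
    (h : ∀ N : ℕ, N ≠ 0 → ∀ S : Fin N → Datum d, p (empirical S)) :
    ∀ᶠ R in sampleFilter P, p R := fun δ hδ =>
  ⟨1, fun N hN => ⟨univ, MeasurableSet.univ, by
    rw [measure_univ, ENNReal.ofReal_le_one]; linarith, fun S _ => h N (by omega) S⟩⟩

/-- The weak law of large numbers. -/
lemma tendsto_integral_sampleFilter {f : Datum d → ℝ} (hf : Measurable f) (hf2 : MemLp f 2 P) :
    Tendsto (fun R => ∫ p, f p ∂ R) (sampleFilter P) (𝓝 (∫ p, f p ∂P)) := by
  rw [Metric.tendsto_nhds]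
  intro ε hε δ hδ
  -- The sample size that Chebyshev's inequality asks for; the `+ 1` below keeps `N` positive.
  obtain ⟨n, hn⟩ := exists_nat_gt (Var[f; P] / (ε ^ 2 * δ))
  refine ⟨n + 1, fun N hN => ?_⟩
  have hN0 : (0 : ℝ) < N := by exact_mod_cast (by omega : 0 < N)
  set Q := Measure.pi fun _ : Fin N => P
  set X : (Fin N → Datum d) → ℝ := ∑ i, fun S => f (S i) with hX
  have hXS : ∀ S, X S = ∑ i, f (S i) := fun S => by simp [hX]
  have hmem : ∀ i : Fin N, MemLp (fun S : Fin N → Datum d => f (S i)) 2 Q := fun i =>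
    hf2.comp_measurePreserving (measurePreserving_eval (fun _ : Fin N => P) i)
  have hX2 : MemLp X 2 Q := memLp_finsetSum' _ fun i _ => hmem i
  have hmean : ∫ S, X S ∂Q = N * ∫ p, f p ∂P := by
    simp_rw [hXS]
    rw [integral_finsetSum _ fun i _ => (hmem i).integrable one_le_two]
    have : ∀ i : Fin N, ∫ S, f (S i) ∂Q = ∫ p, f p ∂P := fun i => by
      have h := (measurePreserving_eval (fun _ : Fin N => P) i)
      rw [← h.map_eq, integral_map h.measurable.aemeasurable
        hf.aestronglyMeasurable]
    simp [this]
  have hvar : Var[X; Q] = N * Var[f; P] := by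
    have := variance_sum_pi (μ := fun _ : Fin N => P) (X := fun _ => f) fun _ => hf2
    rw [hX, this]; simp
  have hcheb := meas_ge_le_variance_div_sq hX2 (mul_pos hε hN0)
  have hXm : Measurable X := by
    have : X = fun S => ∑ i, f (S i) := funext hXS
    rw [this]; fun_prop
  have hGm : MeasurableSet {S | ε * N ≤ |X S - Q[X]|} :=
    measurableSet_le measurable_const (by fun_prop)
  refine ⟨{S | ε * N ≤ |X S - Q[X]|}ᶜ, hGm.compl, ?_, fun S hS => ?_⟩
  · rw [prob_compl_eq_one_sub hGm, ENNReal.ofReal_sub _ hδ.le, ENNReal.ofReal_one]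
    refine tsub_le_tsub_left (hcheb.trans (ENNReal.ofReal_le_ofReal ?_)) 1
    rw [hvar, div_le_iff₀ (by positivity)]
    have h1 : Var[f; P] < N * (ε ^ 2 * δ) := by
      rw [div_lt_iff₀ (by positivity)] at hn
      refine hn.trans_le ?_
      gcongr
      omega
    nlinarith
  · simp only [mem_compl_iff, mem_ofPred_eq, not_le] at hS
    rw [mem_ofPred_eq, integral_empirical, Real.dist_eq, ← hXS]
    have h2 : (N : ℝ)⁻¹ * X S - ∫ p, f p ∂P = (N : ℝ)⁻¹ * (X S - Q[X]) := by
      rw [hmean]; field_simp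
    rw [h2, abs_mul, abs_of_pos (inv_pos.2 hN0), inv_mul_lt_iff₀ hN0]
    linarith

end LawOfLargeNumbers

/-! ### Joint continuity in the measure and the centers -/

section Convergence

variable {d : ℕ}

/-- The measures of the filter converge to `P` on all functions of at most quadratic growth. -/
structure ConvergesTo (F : Filter (Measure (Datum d))) (P : Measure (Datum d)) : Prop where
  isProbabilityMeasure : ∀ᶠ R in F, IsProbabilityMeasure R
  integrable : ∀ᶠ R in F, Integrable (fun p : Datum d => ‖p.2‖ ^ 2) R
  tendsto : ∀ f : Datum d → ℝ, Measurable f → ∀ C, (∀ p, |f p| ≤ C * (1 + ‖p.2‖ ^ 2)) →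
    Tendsto (fun R => ∫ p, f p ∂ R) F (𝓝 (∫ p, f p ∂P))

/-- Makes continuity in the centers alone, for a fixed measure, a special case of joint continuity.
-/
lemma convergesTo_pure {P : Measure (Datum d)} [hp : IsProbabilityMeasure P]
    (hP : Integrable (fun p : Datum d => ‖p.2‖ ^ 2) P) : ConvergesTo (pure P) P where
  isProbabilityMeasure := hp
  integrable := hP
  tendsto f _ _ _ := tendsto_pure_nhds (fun R => ∫ p, f p ∂ R) P

/-- The fourth moment makes functions of quadratic growth square integrable, as Chebyshev's
inequality needs. -/
lemma convergesTo_sampleFilter {P : Measure (Datum d)} [IsProbabilityMeasure P]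
    (hP : MemLp (fun p : Datum d => ‖p.2‖ ^ 2) 2 P) : ConvergesTo (sampleFilter P) P where
  isProbabilityMeasure := eventually_sampleFilter_of_forall P fun _ hN S =>
    isProbabilityMeasure_empirical hN S
  integrable := eventually_sampleFilter_of_forall P fun _ hN S => integrable_empirical hN S _
  tendsto f hf C h := by
    refine tendsto_integral_sampleFilter P hf ?_
    have hg : MemLp (fun p : Datum d => C * (1 + ‖p.2‖ ^ 2)) 2 P :=
      MemLp.const_mul (f := fun p : Datum d => 1 + ‖p.2‖ ^ 2)
        (MemLp.add (f := fun _ => (1 : ℝ)) (memLp_const 1) hP) C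
    exact hg.of_le hf.aestronglyMeasurable (ae_of_all _ fun p => (h p).trans (le_abs_self _))

lemma ConvergesTo.tendsto_real {F : Filter (Measure (Datum d))} {P : Measure (Datum d)}
    (h : ConvergesTo F P) {s : Set (Datum d)} (hs : MeasurableSet s) :
    Tendsto (fun R => R.real s) F (𝓝 (P.real s)) := by
  have := h.tendsto (s.indicator 1) (measurable_one.indicator hs) 1 fun p => by
    by_cases hp : p ∈ s <;> simp [hp]; positivity
  simpa only [integral_indicator_one hs] using this

lemma abs_norm_sub_sq_sub_le {x a b : EuclideanSpace ℝ (Fin d)} {B : ℝ} (ha : ‖a‖ ≤ B)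
    (hb : ‖b‖ ≤ B) :
    |‖x - a‖ ^ 2 - ‖x - b‖ ^ 2| ≤ ‖a - b‖ * ((2 + 2 * B) * (1 + ‖x‖ ^ 2)) := by
  have h1 : |‖x - a‖ - ‖x - b‖| ≤ ‖a - b‖ := by
    refine (abs_norm_sub_norm_le _ _).trans_eq ?_
    rw [sub_sub_sub_cancel_left, norm_sub_rev]
  have h2 := norm_sub_le x a
  have h3 := norm_sub_le x b
  have hB : 0 ≤ B := (norm_nonneg a).trans ha
  rw [sq_sub_sq, abs_mul, mul_comm, abs_of_nonneg (by positivity : 0 ≤ ‖x - a‖ + ‖x - b‖)]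
  refine mul_le_mul h1 ?_ (by positivity) (norm_nonneg _)
  nlinarith [sq_nonneg (‖x‖ - 1), mul_nonneg hB (sq_nonneg ‖x‖)]

lemma abs_cost_sub_cost_le {R : Measure (Datum d)} [IsProbabilityMeasure R]
    (hR : Integrable (fun p : Datum d => ‖p.2‖ ^ 2) R) {θ η : Fin 2 → EuclideanSpace ℝ (Fin d)}
    {B : ℝ} (hθ : ‖θ‖ ≤ B) (hη : ‖η‖ ≤ B) :
    |cost R η - cost R θ| ≤ ‖η - θ‖ * ((2 + 2 * B) * (1 + ∫ p, ‖p.2‖ ^ 2 ∂ R)) := by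
  have hi : Integrable (fun p : Datum d => ‖η - θ‖ * ((2 + 2 * B) * (1 + ‖p.2‖ ^ 2))) R :=
    (((integrable_const 1).add hR).const_mul _).const_mul _
  have h1 : ∫ p, ‖η - θ‖ * ((2 + 2 * B) * (1 + ‖p.2‖ ^ 2)) ∂ R =
      ‖η - θ‖ * ((2 + 2 * B) * (1 + ∫ p, ‖p.2‖ ^ 2 ∂ R)) := by
    rw [integral_const_mul, integral_const_mul, integral_add (integrable_const _) hR]
    simp
  rw [cost, cost, ← integral_sub (integrable_min hR η) (integrable_min hR θ), ← h1]
  refine abs_integral_le_integral_abs.trans (integral_mono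
    ((integrable_min hR η).sub (integrable_min hR θ)).abs hi fun p => ?_)
  have hj : ∀ j, |‖p.2 - η j‖ ^ 2 - ‖p.2 - θ j‖ ^ 2| ≤
      ‖η - θ‖ * ((2 + 2 * B) * (1 + ‖p.2‖ ^ 2)) := fun j => by
    have hB : 0 ≤ B := (norm_nonneg _).trans hθ
    refine (abs_norm_sub_sq_sub_le ((norm_le_pi_norm η j).trans hη)
      ((norm_le_pi_norm θ j).trans hθ)).trans ?_
    gcongr
    exact norm_le_pi_norm (η - θ) j
  exact (abs_min_sub_min_le_max _ _ _ _).trans (max_le (hj 0) (hj 1))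

/-- The cost is jointly continuous in the measure and the centers. -/
lemma ConvergesTo.tendsto_cost {F : Filter (Measure (Datum d))} {P : Measure (Datum d)}
    (h : ConvergesTo F P) (θ : Fin 2 → EuclideanSpace ℝ (Fin d)) :
    Tendsto (fun q : Measure (Datum d) × (Fin 2 → EuclideanSpace ℝ (Fin d)) => cost q.1 q.2)
      (F ×ˢ 𝓝 θ) (𝓝 (cost P θ)) := by
  have h1 : Tendsto (fun q : Measure (Datum d) × (Fin 2 → EuclideanSpace ℝ (Fin d)) =>
      cost q.1 θ) (F ×ˢ 𝓝 θ) (𝓝 (cost P θ)) := by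
    refine (h.tendsto _ (by fun_prop) (2 + 2 * ‖θ 0‖ ^ 2) fun p => ?_).comp tendsto_fst
    rw [abs_of_nonneg (by positivity)]
    exact (min_le_left _ _).trans (norm_sub_sq_le p.2 (θ 0))
  have h2 : Tendsto (fun q : Measure (Datum d) × (Fin 2 → EuclideanSpace ℝ (Fin d)) =>
      cost q.1 q.2 - cost q.1 θ) (F ×ˢ 𝓝 θ) (𝓝 0) := by
    have hm : Tendsto (fun R : Measure (Datum d) => ∫ p, ‖p.2‖ ^ 2 ∂ R) F
        (𝓝 (∫ p, ‖p.2‖ ^ 2 ∂P)) :=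
      h.tendsto _ (by fun_prop) 1 fun p => by rw [abs_of_nonneg (by positivity)]; linarith
    have hb : Tendsto (fun q : Measure (Datum d) × (Fin 2 → EuclideanSpace ℝ (Fin d)) =>
        ‖q.2 - θ‖ * ((2 + 2 * (‖θ‖ + 1)) * (1 + ∫ p, ‖p.2‖ ^ 2 ∂q.1))) (F ×ˢ 𝓝 θ) (𝓝 0) := by
      have hn : Tendsto (fun η : Fin 2 → EuclideanSpace ℝ (Fin d) => ‖η - θ‖) (𝓝 θ) (𝓝 0) :=
        tendsto_norm_sub_self θ
      have := (hn.comp tendsto_snd).mul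
        (((hm.comp tendsto_fst).const_add 1).const_mul (2 + 2 * (‖θ‖ + 1))
          |>.mono_left (le_refl (F ×ˢ 𝓝 θ)))
      rwa [zero_mul] at this
    refine squeeze_zero_norm' ?_ hb
    filter_upwards [h.isProbabilityMeasure.prod_inl (𝓝 θ), h.integrable.prod_inl (𝓝 θ),
      (Metric.ball_mem_nhds θ one_pos |> fun h => Eventually.prod_inr h F)] with q hq1 hq2 hq3
    refine abs_cost_sub_cost_le hq2 (by linarith) ?_
    have h3 := norm_le_norm_add_norm_sub' q.2 θ
    have h4 : ‖q.2 - θ‖ < 1 := by simpa [dist_eq_norm] using hq3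
    linarith
  simpa using h2.add h1

/-- The mass of a class in a cluster is jointly continuous in the measure and the centers. -/
lemma ConvergesTo.tendsto_real_predict {F : Filter (Measure (Datum d))} {P : Measure (Datum d)}
    [IsProbabilityMeasure P] (h : ConvergesTo F P) {θ : Fin 2 → EuclideanSpace ℝ (Fin d)}
    (hθ : P {p | ‖p.2 - θ 0‖ = ‖p.2 - θ 1‖} = 0) (i j : Fin 2) :
    Tendsto (fun q : Measure (Datum d) × (Fin 2 → EuclideanSpace ℝ (Fin d)) =>
      q.1.real {p | p.1 = i ∧ predict q.2 p.2 = j}) (F ×ˢ 𝓝 θ)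
      (𝓝 (P.real {p | p.1 = i ∧ predict θ p.2 = j})) := by
  -- Neighborhoods of the bisector that shrink to it, so their mass tends to `0`. Off `W n`, centers
  -- moved by less than half its width predict the same cluster: both distances may change.
  set W : ℕ → Set (Datum d) := fun n =>
    {p | |‖p.2 - θ 0‖ - ‖p.2 - θ 1‖| ≤ 1 / ((n : ℝ) + 1)} with hW
  have hWm : ∀ n, MeasurableSet (W n) := fun n => measurableSet_le (by fun_prop) measurable_const
  have hW0 : Tendsto (fun n => P.real (W n)) atTop (𝓝 0) := by
    have hanti : Antitone W := fun m n hmn p hp =>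
      le_trans (show |‖p.2 - θ 0‖ - ‖p.2 - θ 1‖| ≤ 1 / ((n : ℝ) + 1) from hp)
        (one_div_le_one_div_of_le (by positivity) (by gcongr))
    have hI : ⋂ n, W n = {p | ‖p.2 - θ 0‖ = ‖p.2 - θ 1‖} := by
      ext p
      simp only [mem_iInter, hW, mem_ofPred_eq]
      refine ⟨fun hp => ?_, fun hp n => by rw [hp]; simp; positivity⟩
      have := ge_of_tendsto' tendsto_one_div_add_atTop_nhds_zero_nat hp
      exact sub_eq_zero.1 (abs_nonpos_iff.1 this)
    have := tendsto_measure_iInter_atTop (μ := P) (fun n => (hWm n).nullMeasurableSet) hanti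
      ⟨0, measure_ne_top _ _⟩
    rw [hI, hθ] at this
    exact (ENNReal.tendsto_toReal ENNReal.zero_ne_top).comp this
  rw [Metric.tendsto_nhds]
  intro ε hε
  obtain ⟨n, hn⟩ := (hW0.eventually (eventually_lt_nhds (half_pos hε))).exists
  have e1 := (h.tendsto_real (hWm n)).eventually (eventually_lt_nhds hn)
  have e2 := Metric.tendsto_nhds.1 (h.tendsto_real (measurableSet_label_and_predict θ i j))
    (ε / 2) (half_pos hε)
  have e3 : ∀ᶠ η in 𝓝 θ, ‖η - θ‖ < 1 / ((n : ℝ) + 1) / 2 := by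
    have := Metric.ball_mem_nhds θ (show 0 < 1 / ((n : ℝ) + 1) / 2 by positivity)
    filter_upwards [this] with η hη
    simpa [dist_eq_norm] using hη
  filter_upwards [e1.prod_inl (𝓝 θ), e2.prod_inl (𝓝 θ), e3.prod_inr F,
    h.isProbabilityMeasure.prod_inl (𝓝 θ)] with q h1 h2 h3 h4
  have hagree : ∀ p ∉ W n, predict q.2 p.2 = predict θ p.2 := fun p hp => by
    have hp' : 1 / ((n : ℝ) + 1) < |‖p.2 - θ 0‖ - ‖p.2 - θ 1‖| := not_le.1 hp
    have hk : ∀ k, |‖p.2 - q.2 k‖ - ‖p.2 - θ k‖| ≤ ‖q.2 - θ‖ := fun k => by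
      refine (abs_norm_sub_norm_le _ _).trans ?_
      rw [sub_sub_sub_cancel_left, norm_sub_rev]
      exact norm_le_pi_norm (q.2 - θ) k
    have k0 := abs_le.1 (hk 0)
    have k1 := abs_le.1 (hk 1)
    unfold predict
    rcases lt_abs.1 hp' with hc | hc
    · rw [if_neg (by linarith), if_neg (by linarith [abs_nonneg (‖p.2 - θ 0‖ - ‖p.2 - θ 1‖),
        show (0 : ℝ) < 1 / ((n : ℝ) + 1) by positivity])]
    · rw [if_pos (by linarith), if_pos (by linarith [abs_nonneg (‖p.2 - θ 0‖ - ‖p.2 - θ 1‖),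
        show (0 : ℝ) < 1 / ((n : ℝ) + 1) by positivity])]
  have s1 : {p : Datum d | p.1 = i ∧ predict q.2 p.2 = j} ⊆
      {p | p.1 = i ∧ predict θ p.2 = j} ∪ W n := fun p hp => by
    by_cases hpW : p ∈ W n
    · exact Or.inr hpW
    · exact Or.inl ⟨hp.1, hagree p hpW ▸ hp.2⟩
  have s2 : {p : Datum d | p.1 = i ∧ predict θ p.2 = j} ⊆
      {p | p.1 = i ∧ predict q.2 p.2 = j} ∪ W n := fun p hp => by
    by_cases hpW : p ∈ W n
    · exact Or.inr hpW
    · exact Or.inl ⟨hp.1, (hagree p hpW).symm ▸ hp.2⟩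
  have t1 := (measureReal_mono (μ := q.1) s1).trans (measureReal_union_le _ _)
  have t2 := (measureReal_mono (μ := q.1) s2).trans (measureReal_union_le _ _)
  rw [Real.dist_eq, abs_lt] at h2 ⊢
  constructor <;> linarith

end Convergence

/-- A finite subcover makes a statement local in `y` uniform over all solutions `y` of `A x y`. -/
lemma eventually_forall_of_isCompact {X Y : Type*} [TopologicalSpace Y] {F : Filter X} {K : Set Y}
    (hK : IsCompact K) {A C : X → Y → Prop} (hA : ∀ᶠ x in F, ∀ y, A x y → y ∈ K)
    (h : ∀ y ∈ K, ∀ᶠ q in F ×ˢ 𝓝 y, A q.1 q.2 → C q.1 q.2) :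
    ∀ᶠ x in F, ∀ y, A x y → C x y := by
  have h1 : ∀ᶠ q in F ×ˢ 𝓝ˢ K, A q.1 q.2 → C q.1 q.2 := hK.mem_prod_nhdsSet_of_forall h
  filter_upwards [hA, h1.curry] with x hx hx' y hy
  exact hx'.self_of_nhdsSet y (hx y hy) hy

lemma tendsto_of_pure_prod {X Y Z : Type*} {a : X} {l : Filter Y} {m : Filter Z} {f : X → Y → Z}
    (h : Tendsto (fun q : X × Y => f q.1 q.2) (pure a ×ˢ l) m) : Tendsto (f a) l m := by
  rw [pure_prod, tendsto_map'_iff] at h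
  exact h

/-! ### Bounded optimal centers and open conditions -/

section Consistency

variable {d : ℕ} {F : Filter (Measure (Datum d))} {P : Measure (Datum d)} [IsProbabilityMeasure P]

/-- A center `b` this far out is useless for points of norm at most `T`, which are nearer to `a`; so
it saves at most a tail integral over the single center `a`. -/
lemma norm_sub_sq_sub_indicator_le_min {x a b : EuclideanSpace ℝ (Fin d)} {T M : ℝ}
    (ha : ‖a‖ ≤ M) (hb : 2 * T + M < ‖b‖) :
    ‖x - a‖ ^ 2 - {x : EuclideanSpace ℝ (Fin d) | T < ‖x‖}.indicator
      (fun x => 2 * ‖x‖ ^ 2 + 2 * M ^ 2) x ≤ min (‖x - a‖ ^ 2) (‖x - b‖ ^ 2) := by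
  have h1 := norm_sub_le x a
  by_cases hx : T < ‖x‖
  · rw [indicator_of_mem (by exact hx)]
    have h2 : ‖x - a‖ ^ 2 ≤ (‖x‖ + M) ^ 2 := by gcongr; linarith
    have h3 : ‖x - a‖ ^ 2 ≤ 2 * ‖x‖ ^ 2 + 2 * M ^ 2 := by nlinarith [sq_nonneg (‖x‖ - M)]
    exact (sub_nonpos.2 h3).trans (by positivity)
  · rw [indicator_of_notMem (by exact hx), sub_zero]
    have h2 := norm_sub_norm_le b x
    rw [norm_sub_rev] at h2
    refine le_min le_rfl ?_
    gcongr
    linarith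

lemma sq_div_two_sub_le {x c : EuclideanSpace ℝ (Fin d)} {M : ℝ} (hM : 0 ≤ M) (hc : M ≤ ‖c‖) :
    M ^ 2 / 2 - ‖x‖ ^ 2 ≤ ‖x - c‖ ^ 2 := by
  have h1 := norm_sub_norm_le c x
  rw [norm_sub_rev] at h1
  have h2 : M ^ 2 ≤ (‖x - c‖ + ‖x‖) ^ 2 := by
    apply pow_le_pow_left₀ hM; linarith
  nlinarith [sq_nonneg (‖x - c‖ - ‖x‖)]

omit [IsProbabilityMeasure P] in
lemma cost_const (c : EuclideanSpace ℝ (Fin d)) :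
    (cost P fun _ => c) = ∫ p, ‖p.2 - c‖ ^ 2 ∂P := by simp [cost]

lemma exists_setIntegral_norm_lt (hP : Integrable (fun p : Datum d => ‖p.2‖ ^ 2) P) (M : ℝ) {ε : ℝ}
    (hε : 0 < ε) : ∃ T : ℝ, 0 ≤ T ∧
      ∫ p, {x : EuclideanSpace ℝ (Fin d) | T < ‖x‖}.indicator
        (fun x => 2 * ‖x‖ ^ 2 + 2 * M ^ 2) p.2 ∂P < ε := by
  set s : ℕ → Set (Datum d) := fun n => {p | (n : ℝ) < ‖p.2‖} with hs
  have hsm : ∀ n, MeasurableSet (s n) := fun n => measurableSet_lt measurable_const (by fun_prop)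
  have hanti : Antitone s := fun m n hmn p hp =>
    lt_of_le_of_lt (Nat.cast_le.2 hmn) (show (n : ℝ) < ‖p.2‖ from hp)
  have hi : Integrable (fun p : Datum d => 2 * ‖p.2‖ ^ 2 + 2 * M ^ 2) P :=
    (hP.const_mul 2).add (integrable_const _)
  have hempty : ⋂ n, s n = ∅ := by
    ext p
    simp only [mem_iInter, mem_empty_iff_false, iff_false, not_forall]
    obtain ⟨n, hn⟩ := exists_nat_ge ‖p.2‖
    exact ⟨n, not_lt.2 hn⟩
  have ht := tendsto_setIntegral_of_antitone hsm hanti ⟨0, hi.integrableOn⟩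
  rw [hempty, setIntegral_empty] at ht
  obtain ⟨n, hn⟩ := (ht.eventually (eventually_lt_nhds hε)).exists
  refine ⟨n, Nat.cast_nonneg n, ?_⟩
  rw [← integral_indicator (hsm n)] at hn
  exact hn

/-- Optimal centers stay bounded if two centers beat every single center. -/
lemma ConvergesTo.exists_norm_le (h : ConvergesTo F P)
    (hP : Integrable (fun p : Datum d => ‖p.2‖ ^ 2) P) {η : Fin 2 → EuclideanSpace ℝ (Fin d)}
    {ε : ℝ} (hε : 0 < ε) (hgap : ∀ c, cost P η + ε ≤ ∫ p, ‖p.2 - c‖ ^ 2 ∂P) :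
    ∃ M, ∀ᶠ R in F, ∀ θ, (∀ η', cost R θ ≤ cost R η') → ‖θ‖ ≤ M := by
  obtain ⟨m, hm⟩ : ∃ m, m = ∫ p, ‖p.2‖ ^ 2 ∂P := ⟨_, rfl⟩
  have hm0 : 0 ≤ m := hm ▸ integral_nonneg fun p => by positivity
  -- Chosen so that `M ^ 2 / 2 > 2 * (m + 1)`: two centers beyond `M` then cost more than a center
  -- at the origin.
  obtain ⟨M, hMdef⟩ : ∃ M, M = 2 * (m + 2) := ⟨_, rfl⟩
  have hM0 : 0 ≤ M := by linarith
  obtain ⟨T, hT0, hT⟩ := exists_setIntegral_norm_lt hP M (half_pos hε)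
  set k : EuclideanSpace ℝ (Fin d) → ℝ := {x : EuclideanSpace ℝ (Fin d) | T < ‖x‖}.indicator
    (fun x => 2 * ‖x‖ ^ 2 + 2 * M ^ 2) with hk
  have hkm : Measurable k := Measurable.indicator (by fun_prop)
    (measurableSet_lt measurable_const (by fun_prop))
  have hkb : ∀ p : Datum d, |k p.2| ≤ (2 + 2 * M ^ 2) * (1 + ‖p.2‖ ^ 2) := fun p => by
    rw [hk, indicator_apply]
    split_ifs
    · rw [abs_of_nonneg (by positivity)]
      nlinarith [mul_nonneg (sq_nonneg M) (sq_nonneg ‖p.2‖)]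
    · rw [abs_zero]; positivity
  have e1 : ∀ᶠ R in F, ∫ p, ‖p.2‖ ^ 2 ∂ R < m + 1 := by
    refine (h.tendsto _ (by fun_prop) 1 fun p => ?_).eventually
      (eventually_lt_nhds (by rw [← hm]; linarith))
    rw [abs_of_nonneg (by positivity)]; linarith
  have e2 : ∀ᶠ R in F, ∀ c ∈ Metric.closedBall (0 : EuclideanSpace ℝ (Fin d)) M,
      cost R η + ∫ p, k p.2 ∂ R < cost R fun _ => c := by
    refine eventually_forall_of_isCompact (A := fun _ c => c ∈ Metric.closedBall 0 M)
      (C := fun R c => cost R η + ∫ p, k p.2 ∂ R < cost R fun _ => c)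
      (isCompact_closedBall 0 M) (Eventually.of_forall fun R c hc => hc) fun c _ => ?_
    have t1 : Tendsto (fun q : Measure (Datum d) × EuclideanSpace ℝ (Fin d) =>
        cost q.1 fun _ => q.2) (F ×ˢ 𝓝 c) (𝓝 (cost P fun _ => c)) :=
      (h.tendsto_cost fun _ => c).comp (tendsto_fst.prodMk
        (((continuous_pi fun _ => continuous_id).tendsto c).comp tendsto_snd))
    have t2 : Tendsto (fun q : Measure (Datum d) × EuclideanSpace ℝ (Fin d) => cost q.1 η)
        (F ×ˢ 𝓝 c) (𝓝 (cost P η)) :=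
      (h.tendsto_cost η).comp (tendsto_fst.prodMk tendsto_const_nhds)
    have t3 : Tendsto (fun q : Measure (Datum d) × EuclideanSpace ℝ (Fin d) =>
        ∫ p, k p.2 ∂ q.1) (F ×ˢ 𝓝 c) (𝓝 (∫ p, k p.2 ∂P)) :=
      (h.tendsto (fun p => k p.2) (hkm.comp measurable_snd) _ hkb).comp tendsto_fst
    have h1 := hgap c
    rw [← cost_const] at h1
    filter_upwards [(t2.add t3).eventually_lt t1 (by linarith)] with q hq _ using hq
  refine ⟨2 * T + M, ?_⟩
  filter_upwards [e1, e2, h.isProbabilityMeasure, h.integrable] with R h1 h2 h3 h4 θ hθ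
  have key : ∀ a b : EuclideanSpace ℝ (Fin d), (∀ x, min (‖x - θ 0‖ ^ 2) (‖x - θ 1‖ ^ 2) =
      min (‖x - a‖ ^ 2) (‖x - b‖ ^ 2)) → ‖b‖ ≤ 2 * T + M := by
    intro a b hab
    by_contra! hb
    -- With `a` bounded, the pair acts as a single center up to a tail, and `η` beats it; otherwise
    -- both centers are far, and `0` beats them.
    rcases le_or_gt ‖a‖ M with ha | ha
    · have h5 := h2 a (by simpa using ha)
      have hki : Integrable (fun p : Datum d => k p.2) R :=
        integrable_of_abs_le h4 (hkm.comp measurable_snd) hkb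
      have h6 : (cost R fun _ => a) - ∫ p, k p.2 ∂ R ≤ cost R θ := by
        rw [cost_const, cost, ← integral_sub (integrable_norm_sub_sq h4 a) hki]
        refine integral_mono ((integrable_norm_sub_sq h4 a).sub hki) (integrable_min h4 _)
          fun p => ?_
        rw [hab]
        exact norm_sub_sq_sub_indicator_le_min ha hb
      linarith [hθ η]
    · have h5 := hθ 0
      have h6 : cost R 0 = ∫ p, ‖p.2‖ ^ 2 ∂ R := by simp [cost]
      have h7 : M ^ 2 / 2 - ∫ p, ‖p.2‖ ^ 2 ∂ R ≤ cost R θ := by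
        have e : M ^ 2 / 2 = ∫ p : Datum d, M ^ 2 / 2 ∂ R := by simp
        rw [e, cost, ← integral_sub (integrable_const _) h4]
        refine integral_mono ((integrable_const _).sub h4) (integrable_min h4 _) fun p => ?_
        rw [hab]
        exact le_min (sq_div_two_sub_le hM0 ha.le) (sq_div_two_sub_le hM0 (by linarith))
      have h8 : 2 * (m + 1) < M ^ 2 / 2 := by rw [hMdef]; nlinarith
      linarith
  rw [pi_norm_le_iff_of_nonneg (by positivity)]
  intro j
  fin_cases j
  · exact key (θ 1) (θ 0) fun x => min_comm _ _
  · exact key (θ 0) (θ 1) fun x => rfl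

omit [IsProbabilityMeasure P] in
-- A strictly better competitor stays strictly better under small changes of measure and centers.
lemma ConvergesTo.eventually_not_optimal (h : ConvergesTo F P)
    {θ : Fin 2 → EuclideanSpace ℝ (Fin d)} (hθ : ¬ ∀ η, cost P θ ≤ cost P η) :
    ∀ᶠ q in F ×ˢ 𝓝 θ, ¬ ∀ η, cost q.1 q.2 ≤ cost q.1 η := by
  push Not at hθ
  obtain ⟨η, hη⟩ := hθ
  have t2 : Tendsto (fun q : Measure (Datum d) × (Fin 2 → EuclideanSpace ℝ (Fin d)) =>
      cost q.1 η) (F ×ˢ 𝓝 θ) (𝓝 (cost P η)) :=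
    (h.tendsto_cost η).comp (tendsto_fst.prodMk tendsto_const_nhds)
  filter_upwards [t2.eventually_lt (h.tendsto_cost θ) hη] with q hq hopt
  exact absurd (hopt η) (not_le.2 hq)

lemma isAligned_iff (R : Measure (Datum d)) [IsProbabilityMeasure R]
    (θ : Fin 2 → EuclideanSpace ℝ (Fin d)) : IsAligned R θ ↔
      R.real {p | p.1 = 0 ∧ predict θ p.2 = 1} + R.real {p | p.1 = 1 ∧ predict θ p.2 = 0} ≤
        R.real {p | p.1 = 0 ∧ predict θ p.2 = 0} + R.real {p | p.1 = 1 ∧ predict θ p.2 = 1} := by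
  have hdisj : ∀ i j : Fin 2, Disjoint {p : Datum d | p.1 = 0 ∧ predict θ p.2 = i}
      {p : Datum d | p.1 = 1 ∧ predict θ p.2 = j} := fun i j =>
    disjoint_left.2 fun p hp hp' => absurd (hp.1.symm.trans hp'.1) (by decide)
  have e1 : {p : Datum d | predict θ p.2 ≠ p.1} = {p | p.1 = 0 ∧ predict θ p.2 = 1} ∪
      {p | p.1 = 1 ∧ predict θ p.2 = 0} := by
    ext p; simp only [mem_ofPred_eq, mem_union]; omega
  have e2 : {p : Datum d | predict θ p.2 = p.1} = {p | p.1 = 0 ∧ predict θ p.2 = 0} ∪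
      {p | p.1 = 1 ∧ predict θ p.2 = 1} := by
    ext p; simp only [mem_ofPred_eq, mem_union]; omega
  rw [← measureReal_union (hdisj 1 0) (measurableSet_label_and_predict θ 1 0),
    ← measureReal_union (hdisj 0 1) (measurableSet_label_and_predict θ 1 1), ← e1, ← e2]
  exact (ENNReal.toReal_le_toReal (measure_ne_top _ _) (measure_ne_top _ _)).symm

lemma ConvergesTo.eventually_not_isAligned (h : ConvergesTo F P)
    {θ : Fin 2 → EuclideanSpace ℝ (Fin d)} (hθ : P {p | ‖p.2 - θ 0‖ = ‖p.2 - θ 1‖} = 0)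
    (hal : ¬ IsAligned P θ) : ∀ᶠ q in F ×ˢ 𝓝 θ, ¬ IsAligned q.1 q.2 := by
  rw [isAligned_iff, not_le] at hal
  filter_upwards [((h.tendsto_real_predict hθ 0 0).add (h.tendsto_real_predict hθ 1 1)).eventually_lt
    ((h.tendsto_real_predict hθ 0 1).add (h.tendsto_real_predict hθ 1 0)) hal,
    h.isProbabilityMeasure.prod_inl (𝓝 θ)] with q hq hq'
  rwa [isAligned_iff, not_le]

lemma ConvergesTo.tendsto_acc (h : ConvergesTo F P)
    {θ : Fin 2 → EuclideanSpace ℝ (Fin d)} (hθ : P {p | ‖p.2 - θ 0‖ = ‖p.2 - θ 1‖} = 0) {j : Fin 2}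
    (hj : P.real {p | p.1 = j} ≠ 0) :
    Tendsto (fun q : Measure (Datum d) × (Fin 2 → EuclideanSpace ℝ (Fin d)) => acc q.1 q.2 j)
      (F ×ˢ 𝓝 θ) (𝓝 (acc P θ j)) := by
  simp only [acc_eq_div]
  exact (h.tendsto_real_predict hθ j j).div
    ((h.tendsto_real (measurableSet_label j)).comp tendsto_fst) hj

end Consistency

/-! ### Consistency for the Gaussian mixture -/

section MixtureConsistency

variable {d : ℕ} {μ₁ μ₂ : EuclideanSpace ℝ (Fin d)} {σ₁ σ₂ : ℝ}

/-- Optimal and aligned centers. -/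
def IsAlignedOptimal (P : Measure (Datum d)) (θ : Fin 2 → EuclideanSpace ℝ (Fin d)) : Prop :=
  (∀ η, cost P θ ≤ cost P η) ∧ IsAligned P θ

lemma memLp_norm_sq_mixture :
    MemLp (fun p : Datum d => ‖p.2‖ ^ 2) 2 (mixture μ₁ μ₂ σ₁ σ₂) := by
  rw [memLp_two_iff_integrable_sq (by fun_prop)]
  have h : ∀ (m : EuclideanSpace ℝ (Fin d)) (s : ℝ),
      Integrable (fun x => (‖x‖ ^ 2) ^ 2) (sphericalGaussian m s) := fun m s => by
    simp_rw [← pow_mul]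
    exact (IsGaussian.memLp_id (sphericalGaussian m s) 4 (by norm_num)).integrable_norm_pow
      (p := 4) (by norm_num)
  exact integrable_mixture (h _ _) (h _ _)

lemma convergesTo_sampleFilter_mixture :
    ConvergesTo (sampleFilter (mixture μ₁ μ₂ σ₁ σ₂)) (mixture μ₁ μ₂ σ₁ σ₂) :=
  convergesTo_sampleFilter memLp_norm_sq_mixture

/-- Along `b - a` the bisector projects to a single point, which the normal law does not charge. -/
lemma sphericalGaussian_bisector {m a b : EuclideanSpace ℝ (Fin d)} {s : ℝ} (hs : 0 < s)
    (hab : a ≠ b) : sphericalGaussian m s {x | ‖x - a‖ = ‖x - b‖} = 0 := by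
  have hba : 0 < ‖b - a‖ := norm_pos_iff.2 (sub_ne_zero.2 hab.symm)
  set u := ‖b - a‖⁻¹ • (b - a) with hu
  have hu1 : ‖u‖ = 1 := by
    rw [hu, norm_smul, norm_inv, norm_norm]; exact inv_mul_cancel₀ hba.ne'
  have hset : {x | ‖m + s • x - a‖ = ‖m + s • x - b‖} ⊆
      (fun x => ⟪u, x⟫) ⁻¹' {(‖b - a‖ / 2 - ⟪u, m - a⟫) / s} := fun x hx => by
    have h1 : ‖m + s • x - a‖ ^ 2 = ‖m + s • x - b‖ ^ 2 := by
      rw [show ‖m + s • x - a‖ = ‖m + s • x - b‖ from hx]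
    rw [show m + s • x - b = (m - a + s • x) - (b - a) by abel,
      show m + s • x - a = m - a + s • x by abel, norm_sub_sq_real (m - a + s • x)] at h1
    have h2 : ⟪m - a + s • x, b - a⟫ = ‖b - a‖ ^ 2 / 2 := by linarith
    have h3 : ⟪u, m - a + s • x⟫ = ‖b - a‖ / 2 := by
      rw [hu, real_inner_smul_left, real_inner_comm, h2]; field_simp
    rw [inner_add_right, real_inner_smul_right] at h3
    rw [mem_preimage, mem_singleton_iff, eq_div_iff hs.ne']
    linarith
  rw [sphericalGaussian_eq_map, Measure.map_apply (by fun_prop)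
    (measurableSet_eq_fun (by fun_prop) (by fun_prop))]
  refine measure_mono_null hset ?_
  rw [← Measure.map_apply (by fun_prop) (measurableSet_singleton _), map_inner_stdGaussian hu1]
  have := nullSingletonClass_gaussianReal (μ := 0) (v := 1) one_ne_zero
  exact measure_singleton _

lemma mixture_bisector (h1 : 0 < σ₁) (h2 : 0 < σ₂) {θ : Fin 2 → EuclideanSpace ℝ (Fin d)}
    (hθ : θ 0 ≠ θ 1) : mixture μ₁ μ₂ σ₁ σ₂ {p | ‖p.2 - θ 0‖ = ‖p.2 - θ 1‖} = 0 := by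
  have hm : MeasurableSet {p : Datum d | ‖p.2 - θ 0‖ = ‖p.2 - θ 1‖} :=
    measurableSet_eq_fun (by fun_prop) (by fun_prop)
  have e1 : (sphericalGaussian μ₁ σ₁).real {x | ‖x - θ 0‖ = ‖x - θ 1‖} = 0 := by
    rw [Measure.real, sphericalGaussian_bisector h1 hθ, ENNReal.toReal_zero]
  have e2 : (sphericalGaussian μ₂ σ₂).real {x | ‖x - θ 0‖ = ‖x - θ 1‖} = 0 := by
    rw [Measure.real, sphericalGaussian_bisector h2 hθ, ENNReal.toReal_zero]
  have h := mixture_real (μ₁ := μ₁) (μ₂ := μ₂) (σ₁ := σ₁) (σ₂ := σ₂) hm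
  simp only [mem_ofPred_eq] at h
  rw [e1, e2] at h
  rw [← measureReal_eq_zero_iff, h]
  norm_num

variable {F : Filter (Measure (Datum d))}

lemma eventually_not_isAlignedOptimal (h1 : 0 < σ₁) (h2 : 0 < σ₂) (hsep : 0 < ‖μ₁ - μ₂‖)
    (h : ConvergesTo F (mixture μ₁ μ₂ σ₁ σ₂)) {θ : Fin 2 → EuclideanSpace ℝ (Fin d)}
    (hθ : ¬ IsAlignedOptimal (mixture μ₁ μ₂ σ₁ σ₂) θ) :
    ∀ᶠ q in F ×ˢ 𝓝 θ, ¬ IsAlignedOptimal q.1 q.2 := by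
  -- Misalignment is known to be stable only where the bisector is null, hence for distinct centers,
  -- and optimality supplies these.
  by_cases hopt : ∀ η, cost (mixture μ₁ μ₂ σ₁ σ₂) θ ≤ cost (mixture μ₁ μ₂ σ₁ σ₂) η
  · have hal : ¬ IsAligned (mixture μ₁ μ₂ σ₁ σ₂) θ := fun hal => hθ ⟨hopt, hal⟩
    filter_upwards [h.eventually_not_isAligned
      (mixture_bisector h1 h2 (optimal_centers_ne hsep hopt)) hal] with q hq hq'
    exact hq hq'.2
  · filter_upwards [h.eventually_not_optimal hopt] with q hq hq'
    exact hq hq'.1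

lemma tendsto_acc_of_isAlignedOptimal (h1 : 0 < σ₁) (h2 : 0 < σ₂) (hsep : 0 < ‖μ₁ - μ₂‖)
    (h : ConvergesTo F (mixture μ₁ μ₂ σ₁ σ₂)) {θ : Fin 2 → EuclideanSpace ℝ (Fin d)}
    (hθ : IsAlignedOptimal (mixture μ₁ μ₂ σ₁ σ₂) θ) (j : Fin 2) :
    Tendsto (fun q : Measure (Datum d) × (Fin 2 → EuclideanSpace ℝ (Fin d)) => acc q.1 q.2 j)
      (F ×ˢ 𝓝 θ) (𝓝 (acc (mixture μ₁ μ₂ σ₁ σ₂) θ j)) :=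
  h.tendsto_acc (mixture_bisector h1 h2 (optimal_centers_ne hsep hθ.1))
    (by rw [mixture_real_label]; norm_num)

lemma tendsto_acc_mixture_of_isAlignedOptimal (h1 : 0 < σ₁) (h2 : 0 < σ₂)
    (hsep : 0 < ‖μ₁ - μ₂‖) {θ : Fin 2 → EuclideanSpace ℝ (Fin d)}
    (hθ : IsAlignedOptimal (mixture μ₁ μ₂ σ₁ σ₂) θ) (j : Fin 2) :
    Tendsto (fun η => acc (mixture μ₁ μ₂ σ₁ σ₂) η j) (𝓝 θ)
      (𝓝 (acc (mixture μ₁ μ₂ σ₁ σ₂) θ j)) :=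
  tendsto_of_pure_prod (f := fun R η => acc R η j) <|
    tendsto_acc_of_isAlignedOptimal h1 h2 hsep (convergesTo_pure integrable_norm_sq_mixture) hθ j

lemma exists_isCompact_of_isAlignedOptimal (hsep : 0 < ‖μ₁ - μ₂‖)
    (h : ConvergesTo F (mixture μ₁ μ₂ σ₁ σ₂)) :
    ∃ K : Set (Fin 2 → EuclideanSpace ℝ (Fin d)), IsCompact K ∧
      ∀ᶠ R in F, ∀ θ, IsAlignedOptimal R θ → θ ∈ K := by
  obtain ⟨M, hM⟩ := h.exists_norm_le integrable_norm_sq_mixture (η := ![μ₁, μ₂])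
    (ε := ‖μ₁ - μ₂‖ ^ 2 / 4) (by positivity) fun c => cost_class_means_add_le c
  refine ⟨Metric.closedBall 0 M, isCompact_closedBall _ _, ?_⟩
  filter_upwards [hM] with R hR θ hθ
  simpa using hR θ hθ.1

end MixtureConsistency

/-! ### Accuracy for the population and for samples -/

section Accuracy

variable {d : ℕ} {μ₁ μ₂ : EuclideanSpace ℝ (Fin d)} {σ₁ σ₁' σ₂ : ℝ}
  {θ θ' : Fin 2 → EuclideanSpace ℝ (Fin d)}

lemma abs_one_sub_acc_lt (h1 : 0 < σ₁) (h12 : σ₁ < σ₂) (h21 : σ₂ < 2 * σ₁)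
    (hsep : 3 * (σ₁ + σ₂) ≤ ‖μ₁ - μ₂‖) (hθ : IsAlignedOptimal (mixture μ₁ μ₂ σ₁ σ₂) θ)
    (j : Fin 2) : |1 - acc (mixture μ₁ μ₂ σ₁ σ₂) θ j| < 0.05 := by
  have h2 : 0 < σ₂ := h1.trans h12
  obtain ⟨t, ht, htD, hz, h0, h1'⟩ :=
    exists_balanced_threshold h1 h12.le (by linarith) hθ.1 hθ.2
  have hb := tail_lt_of_balance_eq_zero (by rw [div_le_div_iff₀ two_pos h2]; linarith)
    ((div_lt_one h2).2 h12)
    (by rw [le_div_iff₀ h2, mul_assoc, add_mul, div_mul_cancel₀ _ h2.ne']; linarith) ht htD hz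
  fin_cases j
  · change |1 - acc (mixture μ₁ μ₂ σ₁ σ₂) θ 0| < 0.05
    rw [h0, sub_sub_cancel, abs_of_nonneg (tail_nonneg _)]
    exact hb.1
  · change |1 - acc (mixture μ₁ μ₂ σ₁ σ₂) θ 1| < 0.05
    rw [h1', sub_sub_cancel, abs_of_nonneg (tail_nonneg _)]
    exact hb.2

lemma acc_one_lt_acc_one (h1 : 0 < σ₁) (h11 : σ₁ < σ₁') (h12 : σ₁' < σ₂) (h21 : σ₂ < 2 * σ₁)
    (hsep : 1.5 * (σ₁' + σ₂) ≤ ‖μ₁ - μ₂‖) (hθ : IsAlignedOptimal (mixture μ₁ μ₂ σ₁ σ₂) θ)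
    (hθ' : IsAlignedOptimal (mixture μ₁ μ₂ σ₁' σ₂) θ') :
    acc (mixture μ₁ μ₂ σ₁ σ₂) θ 1 < acc (mixture μ₁ μ₂ σ₁' σ₂) θ' 1 := by
  have h2 : 0 < σ₂ := by linarith
  obtain ⟨t, ht, htD, hz, -, h⟩ :=
    exists_balanced_threshold h1 (h11.trans h12).le (by linarith) hθ.1 hθ.2
  obtain ⟨t', ht', htD', hz', -, h'⟩ :=
    exists_balanced_threshold (h1.trans h11) h12.le (by linarith) hθ'.1 hθ'.2
  have hlt := balanced_threshold_lt (by rw [div_le_div_iff₀ two_pos h2]; linarith)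
    (div_lt_div_of_pos_right h11 h2) ((div_lt_one h2).2 h12)
    (by rw [le_div_iff₀ h2, mul_assoc, add_mul, div_mul_cancel₀ _ h2.ne']; linarith)
    ht htD hz ht' htD' hz'
  rw [h, h']
  exact sub_lt_sub_left (tail_strictAnti (sub_lt_sub_left hlt _)) _

lemma eventually_abs_one_sub_acc_lt (h1 : 0 < σ₁) (h12 : σ₁ < σ₂) (h21 : σ₂ < 2 * σ₁)
    (hsep : 3 * (σ₁ + σ₂) ≤ ‖μ₁ - μ₂‖) :
    ∀ᶠ R in sampleFilter (mixture μ₁ μ₂ σ₁ σ₂), ∀ θ, IsAlignedOptimal R θ →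
      ∀ j, |1 - acc (mixture μ₁ μ₂ σ₁ σ₂) θ j| < 0.05 ∧ |1 - acc R θ j| < 0.05 := by
  have h2 : 0 < σ₂ := h1.trans h12
  have hpos : 0 < ‖μ₁ - μ₂‖ := by linarith
  obtain ⟨K, hK, hKev⟩ := exists_isCompact_of_isAlignedOptimal (σ₁ := σ₁) (σ₂ := σ₂) hpos
    convergesTo_sampleFilter_mixture
  refine eventually_forall_of_isCompact hK hKev fun θ _ => ?_
  -- Near a population output the strict bound persists by continuity; near any other point there
  -- are eventually no sample outputs.
  by_cases hθ : IsAlignedOptimal (mixture μ₁ μ₂ σ₁ σ₂) θ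
  · have hj : ∀ j, ∀ᶠ q in sampleFilter (mixture μ₁ μ₂ σ₁ σ₂) ×ˢ 𝓝 θ,
        |1 - acc (mixture μ₁ μ₂ σ₁ σ₂) q.2 j| < 0.05 ∧ |1 - acc q.1 q.2 j| < 0.05 := fun j => by
      have hlt := abs_one_sub_acc_lt h1 h12 h21 hsep hθ j
      have l1 := (tendsto_acc_mixture_of_isAlignedOptimal h1 h2 hpos hθ j).const_sub 1 |>.abs
      have l2 := (tendsto_acc_of_isAlignedOptimal h1 h2 hpos
        convergesTo_sampleFilter_mixture hθ j).const_sub 1 |>.abs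
      exact (tendsto_snd.eventually (l1.eventually_lt_const hlt)).and (l2.eventually_lt_const hlt)
    filter_upwards [eventually_all.2 hj] with q hq _ using hq
  · filter_upwards [eventually_not_isAlignedOptimal h1 h2 hpos
      convergesTo_sampleFilter_mixture hθ] with q hq hq'
    exact absurd hq' hq

lemma eventually_acc_one_lt_acc_one (h1 : 0 < σ₁) (h11 : σ₁ < σ₁') (h12 : σ₁' < σ₂)
    (h21 : σ₂ < 2 * σ₁) (hsep : 1.5 * (σ₁' + σ₂) ≤ ‖μ₁ - μ₂‖) :
    ∀ᶠ R in sampleFilter (mixture μ₁ μ₂ σ₁ σ₂) ×ˢ sampleFilter (mixture μ₁ μ₂ σ₁' σ₂), ∀ θ θ',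
      IsAlignedOptimal R.1 θ → IsAlignedOptimal R.2 θ' →
        acc (mixture μ₁ μ₂ σ₁ σ₂) θ 1 < acc (mixture μ₁ μ₂ σ₁' σ₂) θ' 1 ∧
          acc R.1 θ 1 < acc R.2 θ' 1 := by
  have h1' : 0 < σ₁' := h1.trans h11
  have h2 : 0 < σ₂ := h1'.trans h12
  have hpos : 0 < ‖μ₁ - μ₂‖ := by linarith
  obtain ⟨K, hK, hKev⟩ := exists_isCompact_of_isAlignedOptimal (σ₁ := σ₁) (σ₂ := σ₂) hpos
    convergesTo_sampleFilter_mixture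
  obtain ⟨K', hK', hKev'⟩ := exists_isCompact_of_isAlignedOptimal (σ₁ := σ₁') (σ₂ := σ₂) hpos
    convergesTo_sampleFilter_mixture
  -- Compactness is applied to pairs of outputs, since the inequality compares two of them.
  have key := eventually_forall_of_isCompact (hK.prod hK')
    (F := sampleFilter (mixture μ₁ μ₂ σ₁ σ₂) ×ˢ sampleFilter (mixture μ₁ μ₂ σ₁' σ₂))
    (A := fun R η => IsAlignedOptimal R.1 η.1 ∧ IsAlignedOptimal R.2 η.2)
    (C := fun R η => acc (mixture μ₁ μ₂ σ₁ σ₂) η.1 1 < acc (mixture μ₁ μ₂ σ₁' σ₂) η.2 1 ∧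
      acc R.1 η.1 1 < acc R.2 η.2 1) ?_ ?_
  · filter_upwards [key] with R hR θ θ' hθ hθ' using hR (θ, θ') ⟨hθ, hθ'⟩
  · filter_upwards [tendsto_fst.eventually hKev, tendsto_snd.eventually hKev'] with R hR hR' η hη
    exact ⟨hR _ hη.1, hR' _ hη.2⟩
  rintro ⟨θ, θ'⟩ -
  rw [nhds_prod_eq]
  have p : Tendsto (fun q : (Measure (Datum d) × Measure (Datum d)) × _ × _ => (q.1.1, q.2.1))
      ((sampleFilter (mixture μ₁ μ₂ σ₁ σ₂) ×ˢ sampleFilter (mixture μ₁ μ₂ σ₁' σ₂)) ×ˢ 𝓝 θ ×ˢ 𝓝 θ')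
      (sampleFilter (mixture μ₁ μ₂ σ₁ σ₂) ×ˢ 𝓝 θ) := tendsto_fst.prodMap tendsto_fst
  have p' : Tendsto (fun q : (Measure (Datum d) × Measure (Datum d)) × _ × _ => (q.1.2, q.2.2))
      ((sampleFilter (mixture μ₁ μ₂ σ₁ σ₂) ×ˢ sampleFilter (mixture μ₁ μ₂ σ₁' σ₂)) ×ˢ 𝓝 θ ×ˢ 𝓝 θ')
      (sampleFilter (mixture μ₁ μ₂ σ₁' σ₂) ×ˢ 𝓝 θ') := tendsto_snd.prodMap tendsto_snd
  by_cases hθ : IsAlignedOptimal (mixture μ₁ μ₂ σ₁ σ₂) θ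
  · by_cases hθ' : IsAlignedOptimal (mixture μ₁ μ₂ σ₁' σ₂) θ'
    · have hlt := acc_one_lt_acc_one h1 h11 h12 h21 hsep hθ hθ'
      obtain ⟨m, hm, hm'⟩ := exists_between hlt
      have e1 := p.eventually <| tendsto_snd.eventually <|
        (tendsto_acc_mixture_of_isAlignedOptimal h1 h2 hpos hθ 1).eventually_lt_const hm
      have e2 := p'.eventually <| tendsto_snd.eventually <|
        (tendsto_acc_mixture_of_isAlignedOptimal h1' h2 hpos hθ' 1).eventually_const_lt hm'
      have e3 := p.eventually <| (tendsto_acc_of_isAlignedOptimal h1 h2 hpos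
        convergesTo_sampleFilter_mixture hθ 1).eventually_lt_const hm
      have e4 := p'.eventually <| (tendsto_acc_of_isAlignedOptimal h1' h2 hpos
        convergesTo_sampleFilter_mixture hθ' 1).eventually_const_lt hm'
      filter_upwards [e1, e2, e3, e4] with q q1 q2 q3 q4 _ using ⟨q1.trans q2, q3.trans q4⟩
    · filter_upwards [p'.eventually (eventually_not_isAlignedOptimal h1' h2 hpos
        convergesTo_sampleFilter_mixture hθ')] with q hq hq'
      exact absurd hq'.2 hq
  · filter_upwards [p.eventually (eventually_not_isAlignedOptimal h1 h2 hpos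
      convergesTo_sampleFilter_mixture hθ)] with q hq hq'
    exact absurd hq'.1 hq

/-- An event that is eventual along the product of two sample filters has high probability under
every coupling of the two samples. -/
lemma holdsWithProb_of_eventually_prod {P P' : Measure (Datum d)} [IsProbabilityMeasure P]
    [IsProbabilityMeasure P'] {A : Measure (Datum d) × Measure (Datum d) → Prop}
    (h : ∀ᶠ R in sampleFilter P ×ˢ sampleFilter P', A R) {δ : ℝ} (hδ : 0 < δ) :
    ∃ Nbar : ℕ, ∀ N : ℕ, Nbar ≤ N → ∀ Q : Measure ((Fin N → Datum d) × (Fin N → Datum d)),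
      Q.fst = Measure.pi (fun _ => P) → Q.snd = Measure.pi (fun _ => P') →
        HoldsWithProb Q (1 - δ) fun S => A (empirical S.1, empirical S.2) := by
  -- The event contains a rectangle, so a union bound over the two marginals is enough and the
  -- coupling plays no role.
  obtain ⟨B, hB, B', hB', hsub⟩ := mem_prod_iff.1 h
  obtain ⟨n, hn⟩ := hB (δ / 2) (by positivity)
  obtain ⟨n', hn'⟩ := hB' (δ / 2) (by positivity)
  refine ⟨max n n', fun N hN Q h1 h2 => ?_⟩
  have hQ : IsProbabilityMeasure Q := ⟨by rw [← Measure.fst_univ, h1, measure_univ]⟩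
  have e1 := hn N ((le_max_left _ _).trans hN)
  have e2 := hn' N ((le_max_right _ _).trans hN)
  rw [← h1] at e1
  rw [← h2] at e2
  exact ((e1.of_map measurable_fst).and (e2.of_map measurable_snd)).mono
    (by rw [add_halves]) fun S hS => hsub (mk_mem_prod hS.1 hS.2)

end Accuracy

end TwoMeans

theorem theorem1 {d : ℕ} (μ₁ μ₂ : EuclideanSpace ℝ (Fin d)) (σ₂ : ℝ) :
    -- (1) positive correlation: for fixed `μ₁, μ₂, σ₂`, a larger `σ₁` gives a larger `ACC₂`
    (∀ σ₁ σ₁' α α' : ℝ, 0 < σ₁ → 0 < σ₁' → σ₁ < σ₁' →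
      1 < σ₂ / σ₁ → σ₂ / σ₁ < 2 → 1 < σ₂ / σ₁' → σ₂ / σ₁' < 2 →
      TwoMeans.IsSeparated α μ₁ μ₂ σ₁ σ₂ → TwoMeans.IsSeparated α' μ₁ μ₂ σ₁' σ₂ →
      1.5 < α → α < 3 → 1.5 < α' → α' < 3 →
      -- in expectation
      (∀ θ θ' : Fin 2 → EuclideanSpace ℝ (Fin d),
        TwoMeans.IsTwoMeans (TwoMeans.mixture μ₁ μ₂ σ₁ σ₂) θ →
        TwoMeans.IsAligned (TwoMeans.mixture μ₁ μ₂ σ₁ σ₂) θ →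
        TwoMeans.IsTwoMeans (TwoMeans.mixture μ₁ μ₂ σ₁' σ₂) θ' →
        TwoMeans.IsAligned (TwoMeans.mixture μ₁ μ₂ σ₁' σ₂) θ' →
        TwoMeans.acc (TwoMeans.mixture μ₁ μ₂ σ₁ σ₂) θ 1 <
          TwoMeans.acc (TwoMeans.mixture μ₁ μ₂ σ₁' σ₂) θ' 1) ∧
      -- with `N` samples, whatever the joint law of the two samples
      (∀ δ : ℝ, 0 < δ → ∃ Nbar : ℕ, ∀ N : ℕ, Nbar ≤ N →
        ∀ Q : Measure ((Fin N → TwoMeans.Datum d) × (Fin N → TwoMeans.Datum d)),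
          Q.fst = TwoMeans.sampleLaw N μ₁ μ₂ σ₁ σ₂ →
          Q.snd = TwoMeans.sampleLaw N μ₁ μ₂ σ₁' σ₂ →
          TwoMeans.HoldsWithProb Q (1 - δ) fun S =>
            ∀ θ θ' : Fin 2 → EuclideanSpace ℝ (Fin d),
              TwoMeans.IsTwoMeans (TwoMeans.empirical S.1) θ →
              TwoMeans.IsAligned (TwoMeans.empirical S.1) θ →
              TwoMeans.IsTwoMeans (TwoMeans.empirical S.2) θ' →
              TwoMeans.IsAligned (TwoMeans.empirical S.2) θ' →
              TwoMeans.acc (TwoMeans.mixture μ₁ μ₂ σ₁ σ₂) θ 1 <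
                  TwoMeans.acc (TwoMeans.mixture μ₁ μ₂ σ₁' σ₂) θ' 1 ∧
                TwoMeans.acc (TwoMeans.empirical S.1) θ 1 <
                  TwoMeans.acc (TwoMeans.empirical S.2) θ' 1)) ∧
    -- (2) high accuracy on both classes
    (∀ σ₁ α : ℝ, 0 < σ₁ → 1 < σ₂ / σ₁ → σ₂ / σ₁ < 2 →
      TwoMeans.IsSeparated α μ₁ μ₂ σ₁ σ₂ → 3 < α →
      -- in expectation
      (∀ θ : Fin 2 → EuclideanSpace ℝ (Fin d),
        TwoMeans.IsTwoMeans (TwoMeans.mixture μ₁ μ₂ σ₁ σ₂) θ →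
        TwoMeans.IsAligned (TwoMeans.mixture μ₁ μ₂ σ₁ σ₂) θ →
        ∀ j : Fin 2, |1 - TwoMeans.acc (TwoMeans.mixture μ₁ μ₂ σ₁ σ₂) θ j| < 0.05) ∧
      -- with `N` samples
      (∀ δ : ℝ, 0 < δ → ∃ Nbar : ℕ, ∀ N : ℕ, Nbar ≤ N →
        TwoMeans.HoldsWithProb (TwoMeans.sampleLaw N μ₁ μ₂ σ₁ σ₂) (1 - δ) fun S =>
          ∀ θ : Fin 2 → EuclideanSpace ℝ (Fin d),
            TwoMeans.IsTwoMeans (TwoMeans.empirical S) θ →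
            TwoMeans.IsAligned (TwoMeans.empirical S) θ →
            ∀ j : Fin 2, |1 - TwoMeans.acc (TwoMeans.mixture μ₁ μ₂ σ₁ σ₂) θ j| < 0.05 ∧
              |1 - TwoMeans.acc (TwoMeans.empirical S) θ j| < 0.05)) := by
  refine ⟨fun σ₁ σ₁' α α' h1 h1' h11 hγ1 hγ2 hγ1' hγ2' hs hs' hα _ hα' _ => ?_,
    fun σ₁ α h1 hγ1 hγ2 hs hα => ?_⟩
  · rw [lt_div_iff₀ h1'] at hγ1'
    rw [div_lt_iff₀ h1] at hγ2
    have hsep : 1.5 * (σ₁' + σ₂) ≤ ‖μ₁ - μ₂‖ := by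
      rw [show ‖μ₁ - μ₂‖ = α' * (σ₁' + σ₂) from hs']
      exact mul_le_mul_of_nonneg_right hα'.le (by linarith)
    have h12 : σ₁' < σ₂ := by linarith
    refine ⟨fun θ θ' hθ hal hθ' hal' => TwoMeans.acc_one_lt_acc_one h1 h11 h12 hγ2 hsep
      ⟨hθ.optimal, hal⟩ ⟨hθ'.optimal, hal'⟩, fun δ hδ => ?_⟩
    obtain ⟨n, hn⟩ := TwoMeans.holdsWithProb_of_eventually_prod
      (TwoMeans.eventually_acc_one_lt_acc_one h1 h11 h12 hγ2 hsep) hδ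
    exact ⟨n, fun N hN Q hQ hQ' => (hn N hN Q hQ hQ').mono le_rfl
      fun S hS θ θ' hθ hal hθ' hal' => hS θ θ' ⟨hθ.optimal, hal⟩ ⟨hθ'.optimal, hal'⟩⟩
  · rw [lt_div_iff₀ h1] at hγ1
    rw [div_lt_iff₀ h1] at hγ2
    have hsep : 3 * (σ₁ + σ₂) ≤ ‖μ₁ - μ₂‖ := by
      rw [show ‖μ₁ - μ₂‖ = α * (σ₁ + σ₂) from hs]
      exact mul_le_mul_of_nonneg_right hα.le (by linarith)
    have h12 : σ₁ < σ₂ := by linarith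
    refine ⟨fun θ hθ hal => TwoMeans.abs_one_sub_acc_lt h1 h12 hγ2 hsep ⟨hθ.optimal, hal⟩,
      fun δ hδ => ?_⟩
    obtain ⟨n, hn⟩ := TwoMeans.eventually_abs_one_sub_acc_lt h1 h12 hγ2 hsep δ hδ
    exact ⟨n, fun N hN => (hn N hN).mono le_rfl fun S hS θ hθ hal => hS θ ⟨hθ.optimal, hal⟩⟩
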